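/- For a polynomial $p\in\mathbb{R}[x_1,\dots,x_n]$ with $p(0)\neq 0$, let $L_p$ be the linear form on $\mathbb{R}[x_1,\dots,x_n]$ with $L_p(1)=\deg p$ and $$-\log\frac{p(-x)}{p(0)}=\sum_{\alpha\neq0}\frac{1}{|\alpha|}\binom{|\alpha|}{\alpha}L_p(x^\alpha)x^\alpha ,$$ and let $A_0(p)$ and $A_k(p)$ $(1\le k\le n)$ be the symmetric $(n+1)\times(n+1)$ matrices obtained by applying $L_p$ to the entries of $(1,x_1,\dots,x_n)^{\top}(1,x_1,\dots,x_n)$ and of $x_k(1,x_1,\dots,x_n)^{\top}(1,x_1,\dots,x_n)$ respectively. Put $S(p)=\{a\in\mathbb{R}^n : A_0(p)+\sum_k a_kA_k(p)\text{ is positive semidefinite}\}$ and $A_\Sigma(p)=\sum_{k}A_k(p)$. Let $A_n(x)$ be the univariate Eulerian polynomials, $A_0=1$ and $A_n=(n+1)xA_{n-1}+(1-x)(xA_{n-1})'$, and let $A_n(x_1,\dots,x_n)$ be the multivariate Eulerian polynomials, obtained by setting $y_1=\dots=y_n=1$ in the polynomials given by $A_0^h=1$ and $$A^h_n=(x_n+y_n)A^h_{n-1}+x_ny_n\sum_{i=1}^{n-1}\Big(\frac{\partial}{\partial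 x_i}+\frac{\partial}{\partial y_i}\Big)A^h_{n-1}.$$ The univariate bound is $\mathrm{un}(n)=-1/\inf S(A_n(x))$, where $S(A_n(x))\subseteq\mathbb{R}$ is formed from the univariate polynomial $A_n(x)$. The multivariate bound is defined for $n=2m$, $m\ge2$, as follows. Write $A_0,A_\Sigma$ for the matrices of $p=A_n(x_1,\dots,x_n)$. For the vector $w=(y,1,-1,\dots,-1)\in\mathbb{R}^{n+1}$ with indeterminate $y$ put $\tilde D(y)=w^{\top}A_0w$, $\tilde N(y)=w^{\top}A_\Sigma w$, write $\tilde N'\tilde D-\tilde N\tilde D'=ay^2+by+c$, and set $y_n=\frac{b+\sqrt{b^2-4ac}}{2a}$. Let $$v(n)=\big(y_n,(-2^{m-i})_{i=3}^{m},0,\tfrac12,\underbrace{1,\dots,1}_{m}\big)\in\mathbb{R}^{n+1},\quad D=v(n)^{\top}A_0\,v(n),\quad N=v(n)^{\top}A_\Sigma\, v(n),\quad \mathrm{mult}_{v(n)}(n)=\frac ND .$$ Then for all sufficiently large $m$ (with $n=2m$) one has $a\ne0$, $b^2-4ac\ge0$, $D>0$ and $N>0$, and, as $m\to\infty$, $$\mathrm{mult}_{v(2m)}(2m)-\mathrm{un}(2m)\sim\frac38\Big(\frac98\Big)^m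 .$$ In particular, this difference tends to infinity, and it does so exponentially: there are constants $c_1>0$ and $c_2$ such that $c_1(9/8)^m\le \mathrm{mult}_{v(2m)}(2m)-\mathrm{un}(2m)\le c_2(9/8)^m$ for all sufficiently large $m$. -/

import Mathlib

noncomputable section

namespace EulerianRelaxation

open MvPolynomial

/-! ### The spectrahedral relaxation of a polynomial -/

/-- The logarithm `log q = ∑_{k ≥ 1} (-1)^(k+1) (q - 1)^k / k` of a real power series `q` with
constant term `1`, that is, the series `log (1 + T)` with `q - 1` substituted for `T`. -/
def mvLog {n : ℕ} (q : MvPowerSeries (Fin n) ℝ) : MvPowerSeries (Fin n) ℝ :=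
  PowerSeries.subst (q - 1) (PowerSeries.log ℝ)

/-- The normalized reflected polynomial `p(-x) / p(0)`, as a power series. -/
def reflected {n : ℕ} (p : MvPolynomial (Fin n) ℝ) : MvPowerSeries (Fin n) ℝ :=
  ((C (constantCoeff p)⁻¹ * aeval (fun i => -(X i : MvPolynomial (Fin n) ℝ)) p :
    MvPolynomial (Fin n) ℝ) : MvPowerSeries (Fin n) ℝ)

/-- The value `L_p(x^α)`: it is `deg p` for `α = 0`, and for `α ≠ 0` it is determined by
`-log (p(-x) / p(0)) = ∑_{α ≠ 0} (1 / |α|) * multinomial(α) * L_p(x^α) * x^α`. -/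
def LMonomial {n : ℕ} (p : MvPolynomial (Fin n) ℝ) (α : Fin n →₀ ℕ) : ℝ :=
  if α = 0 then (p.totalDegree : ℝ)
  else (α.degree : ℝ) / (α.multinomial : ℝ) *
    MvPowerSeries.coeff α (-mvLog (reflected p))

/-- The linear form `L_p` on the polynomial ring. -/
def LForm {n : ℕ} (p : MvPolynomial (Fin n) ℝ) : MvPolynomial (Fin n) ℝ →ₗ[ℝ] ℝ :=
  (basisMonomials (Fin n) ℝ).constr ℝ (LMonomial p)

/-- The vector of monomials `(1, x₁, …, xₙ)`. -/
def mold (n : ℕ) : Fin (n + 1) → MvPolynomial (Fin n) ℝ :=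
  Fin.cons 1 X

/-- The matrix `A₀`, obtained by applying `L_p` to the entries of
`(1, x₁, …, xₙ)ᵀ (1, x₁, …, xₙ)`. -/
def pencilConst {n : ℕ} (p : MvPolynomial (Fin n) ℝ) : Matrix (Fin (n + 1)) (Fin (n + 1)) ℝ :=
  Matrix.of fun i j => LForm p (mold n i * mold n j)

/-- The matrix `A_k`, obtained by applying `L_p` to the entries of
`x_k (1, x₁, …, xₙ)ᵀ (1, x₁, …, xₙ)`. -/
def pencilCoeff {n : ℕ} (p : MvPolynomial (Fin n) ℝ) (k : Fin n) :
    Matrix (Fin (n + 1)) (Fin (n + 1)) ℝ :=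
  Matrix.of fun i j => LForm p (X k * (mold n i * mold n j))

/-- The sum `A₁ + ⋯ + Aₙ`, which is the coefficient of `x` in the pencil on the diagonal
`x₁ = ⋯ = xₙ = x`. -/
def pencilSum {n : ℕ} (p : MvPolynomial (Fin n) ℝ) : Matrix (Fin (n + 1)) (Fin (n + 1)) ℝ :=
  ∑ k, pencilCoeff p k

/-- The pencil `A₀ + ∑ a_k A_k` associated to `p`, at the point `a`. -/
def pencil {n : ℕ} (p : MvPolynomial (Fin n) ℝ) (a : Fin n → ℝ) :
    Matrix (Fin (n + 1)) (Fin (n + 1)) ℝ :=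
  pencilConst p + ∑ k, a k • pencilCoeff p k

/-- The spectrahedron associated to `p`. -/
def spectrahedron {n : ℕ} (p : MvPolynomial (Fin n) ℝ) : Set (Fin n → ℝ) :=
  {a | (pencil p a).PosSemidef}

/-! ### Eulerian polynomials -/

/-- The univariate Eulerian polynomials: `A₀ = 1` and
`Aₙ = (n + 1) x Aₙ₋₁ + (1 - x) (x Aₙ₋₁)'`; so `A₁ = 1 + x`, `A₂ = 1 + 4 x + x²`. -/
def eulerian : ℕ → Polynomial ℝ
  | 0 => 1
  | n + 1 => Polynomial.C ((n : ℝ) + 2) * Polynomial.X * eulerian n +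
      (1 - Polynomial.X) * Polynomial.derivative (Polynomial.X * eulerian n)

/-- The homogeneous multivariate Eulerian polynomials in `x₁, …, xₙ` (left summand) and
`y₁, …, yₙ` (right summand): `A₀ = 1` and
`Aₙ = (xₙ + yₙ) Aₙ₋₁ + xₙ yₙ ∑_{i < n} (∂/∂xᵢ + ∂/∂yᵢ) Aₙ₋₁`. -/
def mvEulerianHom : (n : ℕ) → MvPolynomial (Fin n ⊕ Fin n) ℝ
  | 0 => 1
  | n + 1 =>
      (X (Sum.inl (Fin.last n)) + X (Sum.inr (Fin.last n))) *
          rename (Sum.map Fin.castSucc Fin.castSucc) (mvEulerianHom n) +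
        X (Sum.inl (Fin.last n)) * X (Sum.inr (Fin.last n)) *
          rename (Sum.map Fin.castSucc Fin.castSucc)
            (∑ i : Fin n, (pderiv (Sum.inl i) (mvEulerianHom n) +
              pderiv (Sum.inr i) (mvEulerianHom n)))

/-- The multivariate Eulerian polynomial `Aₙ(x₁, …, xₙ)`, obtained by setting every `yᵢ = 1`. -/
def mvEulerian (n : ℕ) : MvPolynomial (Fin n) ℝ :=
  aeval (Sum.elim X (fun _ => 1)) (mvEulerianHom n)

/-! ### The univariate bound -/

/-- The univariate Eulerian polynomial, seen as a polynomial in the variables indexed by `Fin 1`. -/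
def eulerianOne (n : ℕ) : MvPolynomial (Fin 1) ℝ :=
  Polynomial.aeval (X 0 : MvPolynomial (Fin 1) ℝ) (eulerian n)

/-- The univariate bound `un(n)`. The left end point of the spectrahedron `S(Aₙ) ⊆ ℝ` is the best
lower bound for the rightmost root of `Aₙ` that the relaxation of the univariate polynomial `Aₙ`
provides; as `Aₙ` is palindromic, its negative inverse is a lower bound for the absolute value of
the leftmost root. -/
def unBound (n : ℕ) : ℝ :=
  -(sInf {x : ℝ | (fun _ => x) ∈ spectrahedron (eulerianOne n)})⁻¹

/-! ### The parameter `y` -/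

/-- The vector `(y, 1, -1, …, -1)` with an indeterminate first entry `y`. -/
def oldVec (n : ℕ) : Fin (n + 1) → Polynomial ℝ :=
  Fin.cons Polynomial.X (fun i : Fin n => if (i : ℕ) = 0 then 1 else -1)

/-- The value `wᵀ A₀ w` at `w = (y, 1, -1, …, -1)`, a polynomial in `y`. -/
def oldD (n : ℕ) : Polynomial ℝ :=
  oldVec n ⬝ᵥ ((pencilConst (mvEulerian n)).map Polynomial.C).mulVec (oldVec n)

/-- The value `wᵀ (A₁ + ⋯ + Aₙ) w` at `w = (y, 1, -1, …, -1)`, a polynomial in `y`. -/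
def oldN (n : ℕ) : Polynomial ℝ :=
  oldVec n ⬝ᵥ ((pencilSum (mvEulerian n)).map Polynomial.C).mulVec (oldVec n)

/-- The polynomial `N' D - N D' = a y² + b y + c` for the vector `(y, 1, -1, …, -1)`. -/
def critPoly (n : ℕ) : Polynomial ℝ :=
  Polynomial.derivative (oldN n) * oldD n - oldN n * Polynomial.derivative (oldD n)

/-- The coefficient `a` of `y²` in `N' D - N D'`. -/
def critA (n : ℕ) : ℝ := (critPoly n).coeff 2

/-- The coefficient `b` of `y` in `N' D - N D'`. -/
def critB (n : ℕ) : ℝ := (critPoly n).coeff 1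

/-- The constant coefficient `c` of `N' D - N D'`. -/
def critC (n : ℕ) : ℝ := (critPoly n).coeff 0

/-- The discriminant `b² - 4 a c`. -/
def critDisc (n : ℕ) : ℝ := critB n ^ 2 - 4 * critA n * critC n

/-- The chosen value `y = (b + √(b² - 4 a c)) / (2 a)`. -/
def yVal (n : ℕ) : ℝ := (critB n + √(critDisc n)) / (2 * critA n)

/-! ### The multivariate bound for `n = 2 m` -/

/-- The vector `(y, (-2^(m-i))_{i=3}^m, 0, 1/2, 1, …, 1)` of length `2 m + 1`, where the final
block of ones has length `m`. In the entry of the variable `x_k` (`k = j + 1` in the code) the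
first block has `i = k + 2`. (The vector makes sense for `m ≥ 2`.) -/
def newVec (m : ℕ) (y : ℝ) : Fin (2 * m + 1) → ℝ :=
  Fin.cons y (fun j : Fin (2 * m) =>
    let k := (j : ℕ) + 1
    if k + 2 ≤ m then -(2 : ℝ) ^ (m - (k + 2))
    else if k + 1 = m then 0
    else if k = m then 1 / 2
    else 1)

/-- The vector `v(n)`, `n = 2 m`: the chosen `y` in the first entry. -/
def vVec (m : ℕ) : Fin (2 * m + 1) → ℝ := newVec m (yVal (2 * m))

/-- `D = vᵀ A₀ v` for `v = v(n)`, `n = 2 m`. -/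
def newD (m : ℕ) : ℝ :=
  vVec m ⬝ᵥ (pencilConst (mvEulerian (2 * m))).mulVec (vVec m)

/-- `N = vᵀ (A₁ + ⋯ + Aₙ) v` for `v = v(n)`, `n = 2 m`. -/
def newN (m : ℕ) : ℝ :=
  vVec m ⬝ᵥ (pencilSum (mvEulerian (2 * m))).mulVec (vVec m)

/-- The multivariate bound `mult_{v(n)}(n) = N / D` for `n = 2 m`: the inequality `D + x N ≥ 0`
on the diagonal reads `x ≥ -D / N`, and the bound is the inverse of `D / N`. -/
def multBound (m : ℕ) : ℝ := newN m / newD m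

end EulerianRelaxation

end

noncomputable section

namespace EulerianRelaxation

open MvPolynomial

/-! Along a line `f(T) = p(Tu)`, the multinomial theorem turns the definition of `L_p` into `-log
f(-T) = ∑ L_p((u·x)^d) T^d / d`. Newton's identities then express `L_p` on the first three powers of
`u·x` through the first three coefficients of `f`. By polarisation, `D = vᵀA₀v` and `N = vᵀA_Σv` at
`v = (y, 1 + δ)` depend only on low coefficients `f_ab = planeCoeff δ n a b` of the Eulerian
polynomial on the plane `s(1,…,1) + tδ`, and these obey a linear recursion in `n`
(`planeCoeff_succ_succ_succ`). For `a = 0` they are Eulerian numbers `e₁, e₂, e₃`, asymptotic to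
`2·4^m, 3·9^m, 4·16^m` when `n = 2m`.

The univariate bound is `N₁/D₁`, the quotient at a stationary vector `(y, 1)` of a 2×2 pencil
(`unBound_eq`). Both bounds have leading order `e₁`, so the comparison uses the excess `E = N - e₁D`
and the identity `N/D - N₁/D₁ = ((E - E₁) - (E₁/D₁)(D - D₁))/D`. The geometric entries of `v(n)`
give `f₁₁ ~ -8^m` and `f₁₂ ~ -(3/4)18^m`. Apart from terms in `f₁₀`, `E - E₁` is dominated by `2f₁₂
~ -(3/2)18^m` and `D - D₁` by `-2f₁₁ ~ 2·8^m`; moreover `E₁/D₁ ~ -(3/2)(9/4)^m`. The numerator is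
thus `(-3/2 + 3)18^m`, and dividing by `D ~ 4·16^m` gives `(3/8)(9/8)^m`.

Two points need care. The coefficient `f₁₀` is only known to be `O(m 2^m)`, which alone would be too
large, but its contributions to `E - E₁` and `D - D₁` cancel to leading order (`softO_cross`). The
first entry `y` is optimal for another vector; it differs from the univariate optimum by a
polynomial factor at most (`softO_optY_sub`), and a factor `1/n` makes it `o((9/4)^m)`, so that `y
f₁₁ = o(18^m)`. -/

/-! ### Values of `L_p` on powers of linear forms. -/

/-- The restriction `T ↦ p (T u)` of `p` to the line through the origin in direction `u`. -/
def lineRestrict {n : ℕ} (p : MvPolynomial (Fin n) ℝ) (u : Fin n → ℝ) : Polynomial ℝ :=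
  aeval (fun i => Polynomial.C (u i) * Polynomial.X) p

/-- The linear form `∑ uᵢ xᵢ`. -/
def linForm {n : ℕ} (u : Fin n → ℝ) : MvPolynomial (Fin n) ℝ :=
  ∑ i, C (u i) * X i

lemma linForm_add {n : ℕ} (u v : Fin n → ℝ) : linForm (u + v) = linForm u + linForm v := by
  simp [linForm, add_mul, Finset.sum_add_distrib]

lemma linForm_sub {n : ℕ} (u v : Fin n → ℝ) : linForm (u - v) = linForm u - linForm v := by
  simp [linForm, sub_mul, Finset.sum_sub_distrib]

lemma LForm_monomial {n : ℕ} (p : MvPolynomial (Fin n) ℝ) (α : Fin n →₀ ℕ) (c : ℝ) :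
    LForm p (monomial α c) = c * LMonomial p α := by
  have h : monomial α c = c • (basisMonomials (Fin n) ℝ) α := by
    simp [coe_basisMonomials, smul_monomial]
  rw [h, map_smul, LForm, Module.Basis.constr_basis, smul_eq_mul]

lemma LForm_one {n : ℕ} (p : MvPolynomial (Fin n) ℝ) : LForm p 1 = p.totalDegree := by
  have := LForm_monomial p 0 1
  rw [one_mul] at this
  rw [show (1 : MvPolynomial (Fin n) ℝ) = monomial 0 1 from rfl, this]
  simp [LMonomial]

/-- The multinomial coefficient from expanding the power cancels the one in the denominator of
`LMonomial`; of its weight only `|α| = d` survives. -/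
lemma LForm_linForm_pow_eq_sum {n : ℕ} (p : MvPolynomial (Fin n) ℝ) (u : Fin n → ℝ) (d : ℕ)
    (hd : d ≠ 0) :
    LForm p (linForm u ^ d) = d * ∑ k ∈ Finset.piAntidiag Finset.univ d,
      (∏ i, u i ^ k i) *
        MvPowerSeries.coeff (Finsupp.equivFunOnFinite.symm k) (-mvLog (reflected p)) := by
  rw [linForm, Finset.sum_pow_eq_sum_piAntidiag, map_sum, Finset.mul_sum]
  refine Finset.sum_congr rfl fun k hk => ?_
  have hk' : ∑ i, k i = d := (Finset.mem_piAntidiag.1 hk).1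
  set α : Fin n →₀ ℕ := Finsupp.equivFunOnFinite.symm k with hα
  have hαk : ⇑α = k := rfl
  have hdeg : α.degree = d := by
    rw [Finsupp.degree_eq_sum, hαk, hk']
  have hα0 : α ≠ 0 := by
    rintro h; rw [h] at hdeg; simp at hdeg; exact hd hdeg.symm
  have hmon : (Nat.multinomial Finset.univ k : MvPolynomial (Fin n) ℝ) *
      ∏ i, (C (u i) * X i) ^ k i =
      monomial α ((Nat.multinomial Finset.univ k : ℝ) * ∏ i, u i ^ k i) := by
    rw [monomial_eq, Finsupp.prod_fintype _ _ (by simp)]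
    simp [mul_pow, Finset.prod_mul_distrib, hαk, mul_assoc]
  have hm : α.multinomial = Nat.multinomial Finset.univ k := by
    rw [Finsupp.multinomial_eq_of_support_subset (Finset.subset_univ _), hαk]
  rw [hmon, LForm_monomial, LMonomial, if_neg hα0, hdeg, hm]
  have h0 : (Nat.multinomial Finset.univ k : ℝ) ≠ 0 := by
    exact_mod_cast (Nat.multinomial_pos _ _).ne'
  field_simp

lemma hasSubst_line {n : ℕ} (u : Fin n → ℝ) :
    MvPowerSeries.HasSubst (fun i => (PowerSeries.C (u i) * PowerSeries.X : PowerSeries ℝ)) := by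
  apply MvPowerSeries.hasSubst_of_constantCoeff_zero
  intro i
  change PowerSeries.constantCoeff _ = 0
  simp

lemma coeff_subst_line {n : ℕ} (u : Fin n → ℝ) (f : MvPowerSeries (Fin n) ℝ) (d : ℕ) :
    PowerSeries.coeff d (MvPowerSeries.subst
      (fun i => (PowerSeries.C (u i) * PowerSeries.X : PowerSeries ℝ)) f) =
    ∑ k ∈ Finset.piAntidiag Finset.univ d, (∏ i, u i ^ k i) *
        MvPowerSeries.coeff (Finsupp.equivFunOnFinite.symm k) f := by
  have key : ∀ α : Fin n →₀ ℕ, PowerSeries.coeff d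
      (α.prod fun s e => (PowerSeries.C (u s) * PowerSeries.X : PowerSeries ℝ) ^ e) =
      if ∑ i, α i = d then ∏ i, u i ^ α i else 0 := by
    intro α
    rw [Finsupp.prod_fintype _ _ (by simp)]
    simp only [mul_pow, Finset.prod_mul_distrib, Finset.prod_pow_eq_pow_sum, ← map_pow, ← map_prod]
    rw [PowerSeries.coeff_C_mul, PowerSeries.coeff_X_pow]
    simp [eq_comm]
  rw [PowerSeries.coeff, MvPowerSeries.coeff_subst (hasSubst_line u)]
  rw [finsum_eq_sum_of_support_subset (s := (Finset.piAntidiag Finset.univ d).map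
    (Finsupp.equivFunOnFinite : (Fin n →₀ ℕ) ≃ (Fin n → ℕ)).symm.toEmbedding)]
  · rw [Finset.sum_map]
    refine Finset.sum_congr rfl fun k hk => ?_
    have := key (Finsupp.equivFunOnFinite.symm k)
    rw [PowerSeries.coeff] at this
    have hk' : ∑ i, k i = d := (Finset.mem_piAntidiag.1 hk).1
    simp only [Equiv.coe_toEmbedding, this]
    simp [hk', mul_comm]
  · intro α hα
    have h2 := key α
    rw [PowerSeries.coeff] at h2
    simp only [Function.mem_support, h2] at hα
    simp only [Finset.coe_map, Set.mem_image, Finset.mem_coe]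
    refine ⟨α, ?_, by simp⟩
    rw [Finset.mem_piAntidiag]
    refine ⟨?_, by simp⟩
    by_contra h
    simp [h] at hα

lemma LForm_linForm_pow {n : ℕ} (p : MvPolynomial (Fin n) ℝ) (u : Fin n → ℝ) (d : ℕ)
    (hd : d ≠ 0) :
    LForm p (linForm u ^ d) = -(d * PowerSeries.coeff d (MvPowerSeries.subst
      (fun i => (PowerSeries.C (u i) * PowerSeries.X : PowerSeries ℝ)) (mvLog (reflected p)))) := by
  rw [LForm_linForm_pow_eq_sum p u d hd, coeff_subst_line]
  simp

lemma lineRestrict_neg {n : ℕ} (p : MvPolynomial (Fin n) ℝ) (u : Fin n → ℝ) :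
    lineRestrict p (-u) = (lineRestrict p u).comp (Polynomial.C (-1) * Polynomial.X) := by
  have : (Polynomial.compRingHom (Polynomial.C (-1) * Polynomial.X : Polynomial ℝ)).comp
      (aeval (R := ℝ) (fun i => Polynomial.C (u i) * Polynomial.X :
        Fin n → Polynomial ℝ)).toRingHom =
      (aeval (R := ℝ) (fun i => Polynomial.C ((-u) i) * Polynomial.X :
        Fin n → Polynomial ℝ)).toRingHom := by
    apply MvPolynomial.ringHom_ext
    · intro r; simp
    · intro i; simp
  exact (DFunLike.congr_fun this p).symm

lemma subst_reflected {n : ℕ} (p : MvPolynomial (Fin n) ℝ) (hp : constantCoeff p = 1)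
    (u : Fin n → ℝ) :
    MvPowerSeries.subst (fun i => (PowerSeries.C (u i) * PowerSeries.X : PowerSeries ℝ))
      (reflected p) = (lineRestrict p (-u) : PowerSeries ℝ) := by
  rw [reflected, MvPowerSeries.subst_coe, hp]
  have : ((aeval (fun i => (PowerSeries.C (u i) * PowerSeries.X : PowerSeries ℝ))).comp
      (aeval (fun i => -(X i : MvPolynomial (Fin n) ℝ)))).toRingHom =
      (Polynomial.coeToPowerSeries.ringHom).comp
      (aeval (R := ℝ) (fun i => Polynomial.C ((-u) i) * Polynomial.X :
        Fin n → Polynomial ℝ)).toRingHom := by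
    apply MvPolynomial.ringHom_ext
    · intro r; simp
    · intro i; simp
  rw [inv_one, C_1, one_mul]
  exact DFunLike.congr_fun this p

lemma coeff_zero_lineRestrict {n : ℕ} (p : MvPolynomial (Fin n) ℝ) (u : Fin n → ℝ) :
    (lineRestrict p u).coeff 0 = constantCoeff p := by
  have : (Polynomial.constantCoeff).comp
      (aeval (R := ℝ) (fun i => Polynomial.C (u i) * Polynomial.X :
        Fin n → Polynomial ℝ)).toRingHom =
      constantCoeff := by
    apply MvPolynomial.ringHom_ext
    · intro r; simp
    · intro i; simp
  exact DFunLike.congr_fun this p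

lemma coeff_subst_log {b : PowerSeries ℝ} (hb : PowerSeries.constantCoeff b = 0) (d : ℕ) :
    PowerSeries.coeff d (PowerSeries.subst b (PowerSeries.log ℝ)) =
      ∑ k ∈ Finset.range (d + 1), PowerSeries.coeff k (PowerSeries.log ℝ) *
        PowerSeries.coeff d (b ^ k) := by
  rw [PowerSeries.coeff_subst' (PowerSeries.HasSubst.of_constantCoeff_zero' hb),
    finsum_eq_sum_of_support_subset (s := Finset.range (d + 1))]
  · simp
  · intro k hk
    by_contra hkd
    apply hk
    have hkd' : d < k := by simpa [Nat.lt_succ_iff] using hkd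
    have : (PowerSeries.X : PowerSeries ℝ) ^ k ∣ b ^ k :=
      pow_dvd_pow_of_dvd (PowerSeries.X_dvd_iff.2 hb) k
    simp [PowerSeries.X_pow_dvd_iff.1 this d hkd']

/-- Restriction to a line commutes with substitution into the logarithm. What is left is a
univariate logarithm, and the sum stops at `k = d` because `lineRestrict p (-u) - 1` is divisible by
`T`. -/
lemma LForm_linForm_pow_eq_coeff_subst {n : ℕ} (p : MvPolynomial (Fin n) ℝ)
    (hp : constantCoeff p = 1) (u : Fin n → ℝ) (d : ℕ) (hd : d ≠ 0) :
    LForm p (linForm u ^ d) = -(d * ∑ k ∈ Finset.range (d + 1),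
      PowerSeries.coeff k (PowerSeries.log ℝ) *
        ((lineRestrict p (-u) - 1) ^ k).coeff d) := by
  have h0 : (lineRestrict p (-u)).coeff 0 = 1 := by rw [coeff_zero_lineRestrict, hp]
  have hb : PowerSeries.constantCoeff ((lineRestrict p (-u) : PowerSeries ℝ) - 1) = 0 := by
    rw [map_sub, ← PowerSeries.coeff_zero_eq_constantCoeff_apply, Polynomial.coeff_coe, h0]
    simp
  have hc : MvPowerSeries.constantCoeff (reflected p) = 1 := by
    rw [reflected, ← MvPowerSeries.coeff_zero_eq_constantCoeff_apply, MvPolynomial.coeff_coe,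
      ← MvPolynomial.constantCoeff_eq, hp]
    have : (constantCoeff).comp
      (aeval (fun i => -(X i : MvPolynomial (Fin n) ℝ))).toRingHom = constantCoeff := by
      apply MvPolynomial.ringHom_ext
      · intro r; simp
      · intro i; simp
    have := DFunLike.congr_fun this p
    simp at this
    simp [this, hp]
  have hs : MvPowerSeries.HasSubst (fun _ : Unit => reflected p - 1) :=
    (PowerSeries.HasSubst.of_constantCoeff_zero (by simp [hc])).const
  rw [LForm_linForm_pow p u d hd, mvLog, PowerSeries.subst,
    MvPowerSeries.subst_comp_subst_apply hs (hasSubst_line u)]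
  have h1 : (MvPowerSeries.subst
      (fun i => (PowerSeries.C (u i) * PowerSeries.X : PowerSeries ℝ)) (reflected p - 1)) =
      (lineRestrict p (-u) : PowerSeries ℝ) - 1 := by
    rw [← MvPowerSeries.coe_substAlgHom (hasSubst_line u), map_sub, map_one,
      MvPowerSeries.coe_substAlgHom (hasSubst_line u), subst_reflected p hp]
  have h2 := coeff_subst_log hb d
  rw [PowerSeries.subst] at h2
  rw [h1, h2]
  congr 3 with k
  rw [← Polynomial.coeff_coe]
  simp

/-- Newton's identities for `L_p` on powers of a linear form. -/
lemma LForm_linForm {n : ℕ} (p : MvPolynomial (Fin n) ℝ)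
    (hp : constantCoeff p = 1) (u : Fin n → ℝ) :
    LForm p (linForm u) = (lineRestrict p u).coeff 1 := by
  have h := LForm_linForm_pow_eq_coeff_subst p hp u 1 one_ne_zero
  rw [pow_one] at h
  rw [h, lineRestrict_neg]
  simp [-map_neg, Finset.sum_range_succ, Polynomial.coeff_one, Polynomial.comp_C_mul_X_coeff]

lemma LForm_linForm_sq {n : ℕ} (p : MvPolynomial (Fin n) ℝ)
    (hp : constantCoeff p = 1) (u : Fin n → ℝ) :
    LForm p (linForm u ^ 2) =
      (lineRestrict p u).coeff 1 ^ 2 - 2 * (lineRestrict p u).coeff 2 := by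
  have h := LForm_linForm_pow_eq_coeff_subst p hp u 2 two_ne_zero
  have h0 : (lineRestrict p u).coeff 0 = 1 := by rw [coeff_zero_lineRestrict, hp]
  rw [h, lineRestrict_neg]
  simp [-map_neg, Finset.sum_range_succ, Polynomial.coeff_one, pow_succ, Polynomial.coeff_mul, h0,
    Finset.Nat.antidiagonal_succ, Polynomial.comp_C_mul_X_coeff]
  ring

lemma LForm_linForm_cube {n : ℕ} (p : MvPolynomial (Fin n) ℝ)
    (hp : constantCoeff p = 1) (u : Fin n → ℝ) :
    LForm p (linForm u ^ 3) =
      (lineRestrict p u).coeff 1 ^ 3 - 3 * (lineRestrict p u).coeff 1 * (lineRestrict p u).coeff 2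
        + 3 * (lineRestrict p u).coeff 3 := by
  have h := LForm_linForm_pow_eq_coeff_subst p hp u 3 three_ne_zero
  have h0 : (lineRestrict p u).coeff 0 = 1 := by rw [coeff_zero_lineRestrict, hp]
  rw [h, lineRestrict_neg]
  simp [-map_neg, Finset.sum_range_succ, Polynomial.coeff_one, pow_succ, Polynomial.coeff_mul, h0,
    Finset.Nat.antidiagonal_succ, Polynomial.comp_C_mul_X_coeff]
  ring

/-! ### Restriction of the multivariate Eulerian polynomials to planes through the diagonal -/

/-- The coefficient of `tᵃ sᵇ` of a polynomial in `s` (outer variable) and `t` (inner variable). -/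
def bicoeff (f : Polynomial (Polynomial ℝ)) (a b : ℕ) : ℝ := (f.coeff b).coeff a

lemma bicoeff_add (f g : Polynomial (Polynomial ℝ)) (a b : ℕ) :
    bicoeff (f + g) a b = bicoeff f a b + bicoeff g a b := by
  simp [bicoeff]

lemma bicoeff_derivative (f : Polynomial (Polynomial ℝ)) (a b : ℕ) :
    bicoeff (Polynomial.derivative f) a b = (b + 1) * bicoeff f a (b + 1) := by
  have : ((b : Polynomial ℝ) + 1) = Polynomial.C ((b : ℝ) + 1) := by simp
  rw [bicoeff, Polynomial.coeff_derivative, this, Polynomial.coeff_mul_C, mul_comm, bicoeff]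

/-- The linear polynomial `s + c t`. -/
def planeVar (c : ℝ) : Polynomial (Polynomial ℝ) :=
  Polynomial.X + Polynomial.C (Polynomial.C c * Polynomial.X)

lemma bicoeff_planeVar_mul_zero_zero (c : ℝ) (g : Polynomial (Polynomial ℝ)) :
    bicoeff (planeVar c * g) 0 0 = 0 := by
  simp [planeVar, bicoeff, Polynomial.mul_coeff_zero]

lemma bicoeff_planeVar_mul_zero_succ (c : ℝ) (g : Polynomial (Polynomial ℝ)) (b : ℕ) :
    bicoeff (planeVar c * g) 0 (b + 1) = bicoeff g 0 b := by
  rw [planeVar, bicoeff, add_mul, Polynomial.coeff_add, Polynomial.coeff_X_mul,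
    Polynomial.coeff_C_mul, mul_assoc, Polynomial.coeff_add, Polynomial.coeff_C_mul]
  simp [bicoeff, Polynomial.mul_coeff_zero]

lemma bicoeff_planeVar_mul_succ_zero (c : ℝ) (g : Polynomial (Polynomial ℝ)) (a : ℕ) :
    bicoeff (planeVar c * g) (a + 1) 0 = c * bicoeff g a 0 := by
  rw [planeVar, bicoeff, add_mul, Polynomial.coeff_add,
    Polynomial.coeff_C_mul, mul_assoc, Polynomial.coeff_add, Polynomial.coeff_C_mul,
    Polynomial.coeff_X_mul]
  simp [bicoeff, Polynomial.mul_coeff_zero]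

lemma bicoeff_planeVar_mul_succ_succ (c : ℝ) (g : Polynomial (Polynomial ℝ)) (a b : ℕ) :
    bicoeff (planeVar c * g) (a + 1) (b + 1) = bicoeff g (a + 1) b + c * bicoeff g a (b + 1) := by
  rw [planeVar, bicoeff, add_mul, Polynomial.coeff_add, Polynomial.coeff_X_mul,
    Polynomial.coeff_C_mul, mul_assoc, Polynomial.coeff_add, Polynomial.coeff_C_mul,
    Polynomial.coeff_X_mul]
  simp [bicoeff]

/-- The substitution `xᵢ ↦ s + δᵢ t`, `yᵢ ↦ 1`. -/
def planeHom (δ : ℕ → ℝ) (n : ℕ) :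
    MvPolynomial (Fin n ⊕ Fin n) ℝ →ₐ[ℝ] Polynomial (Polynomial ℝ) :=
  aeval (Sum.elim (fun i : Fin n => planeVar (δ i)) (fun _ => 1))

/-- The restriction of the `n`-th multivariate Eulerian polynomial to the plane of the points
`s (1, …, 1) + t δ`. -/
def planeEulerian (δ : ℕ → ℝ) (n : ℕ) : Polynomial (Polynomial ℝ) :=
  planeHom δ n (mvEulerianHom n)

lemma planeHom_inl (δ : ℕ → ℝ) {n : ℕ} (i : Fin n) :
    planeHom δ n (X (Sum.inl i)) = planeVar (δ i) := by simp [planeHom]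

lemma planeHom_inr (δ : ℕ → ℝ) {n : ℕ} (i : Fin n) :
    planeHom δ n (X (Sum.inr i)) = 1 := by simp [planeHom]

lemma planeHom_C (δ : ℕ → ℝ) {n : ℕ} (r : ℝ) :
    planeHom δ n (C r) = Polynomial.C (Polynomial.C r) := by simp [planeHom]

lemma planeHom_rename (δ : ℕ → ℝ) {n : ℕ} (p : MvPolynomial (Fin n ⊕ Fin n) ℝ) :
    planeHom δ (n + 1) (rename (Sum.map Fin.castSucc Fin.castSucc) p) = planeHom δ n p := by
  rw [planeHom, aeval_rename, Sum.elim_comp_map]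
  rfl

/-- Chain rule: moving all `xᵢ` at equal speed is moving `s`. -/
lemma planeHom_sum_pderiv_inl (δ : ℕ → ℝ) {n : ℕ} (p : MvPolynomial (Fin n ⊕ Fin n) ℝ) :
    planeHom δ n (∑ i, pderiv (Sum.inl i) p) = Polynomial.derivative (planeHom δ n p) := by
  induction p using MvPolynomial.induction_on with
  | C a => simp
  | add p q hp hq =>
    simp only [map_add, Finset.sum_add_distrib] at *
    rw [hp, hq]
  | mul_X p j h =>
    simp only [Derivation.leibniz, smul_eq_mul, Finset.sum_add_distrib, ← Finset.mul_sum, map_add,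
      map_mul, h, Polynomial.derivative_mul, pderiv_X]
    cases j with
    | inl j =>
      simp [Pi.single_apply, planeHom_inl, planeVar]
      ring
    | inr j => simp [planeHom_inr]

/-- Each `s + δᵢt` is homogeneous of degree one, so the Euler operator in the `x` variables becomes
the degree operator in `s, t`. -/
lemma bicoeff_planeHom_euler (δ : ℕ → ℝ) {n : ℕ} (p : MvPolynomial (Fin n ⊕ Fin n) ℝ) (a b : ℕ) :
    bicoeff (planeHom δ n (∑ i, X (Sum.inl i) * pderiv (Sum.inl i) p)) a b =
      (a + b) * bicoeff (planeHom δ n p) a b := by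
  induction p using MvPolynomial.induction_on generalizing a b with
  | C r =>
    simp only [pderiv_C, mul_zero, Finset.sum_const_zero, map_zero, planeHom_C]
    cases b with
    | zero => cases a <;> simp [bicoeff, Polynomial.coeff_C]
    | succ b => simp [bicoeff]
  | add p q hp hq =>
    simp only [map_add, mul_add, Finset.sum_add_distrib] at *
    rw [bicoeff_add, bicoeff_add, hp, hq]
    ring
  | mul_X p j h =>
    have e : ∑ i, X (Sum.inl i) * pderiv (Sum.inl i) (p * X j) =
        X j * (∑ i, X (Sum.inl i) * pderiv (Sum.inl i) p) +
          p * ∑ i, X (Sum.inl i) * pderiv (Sum.inl i) (X j : MvPolynomial (Fin n ⊕ Fin n) ℝ) := by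
      rw [Finset.mul_sum, Finset.mul_sum, ← Finset.sum_add_distrib]
      refine Finset.sum_congr rfl fun i _ => ?_
      simp only [Derivation.leibniz, smul_eq_mul]
      ring
    rw [e]
    cases j with
    | inl j =>
      have e2 : ∑ i, X (Sum.inl i) * pderiv (Sum.inl i)
          (X (Sum.inl j) : MvPolynomial (Fin n ⊕ Fin n) ℝ) = X (Sum.inl j) := by
        simp [pderiv_X, Pi.single_apply]
      rw [e2, mul_comm p, ← mul_add, map_mul, map_mul, planeHom_inl, map_add]
      cases a with
      | zero =>
        cases b with
        | zero => simp [bicoeff_planeVar_mul_zero_zero]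
        | succ b =>
          simp only [bicoeff_planeVar_mul_zero_succ, bicoeff_add, h]
          push_cast; ring
      | succ a =>
        cases b with
        | zero =>
          simp only [bicoeff_planeVar_mul_succ_zero, bicoeff_add, h]
          push_cast; ring
        | succ b =>
          simp only [bicoeff_planeVar_mul_succ_succ, bicoeff_add, h]
          push_cast; ring
    | inr j =>
      simp only [ne_eq, reduceCtorEq, not_false_eq_true, pderiv_X_of_ne, mul_zero,
        Finset.sum_const_zero, add_zero, map_mul, planeHom_inr, one_mul, mul_one]
      exact h a b

lemma isHomogeneous_mvEulerianHom (n : ℕ) : (mvEulerianHom n).IsHomogeneous n := by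
  induction n with
  | zero => exact isHomogeneous_one _ _
  | succ n ih =>
    rw [mvEulerianHom]
    refine IsHomogeneous.add ?_ ?_
    · have h2 := ((isHomogeneous_X ℝ (Sum.inl (Fin.last n) : Fin (n + 1) ⊕ Fin (n + 1))).add
          (isHomogeneous_X ℝ (Sum.inr (Fin.last n)))).mul
          (ih.rename_isHomogeneous (f := Sum.map Fin.castSucc Fin.castSucc))
      convert h2 using 1
      ring
    · cases n with
      | zero => simp [isHomogeneous_zero]
      | succ n =>
        have : (∑ i : Fin (n + 1), (pderiv (Sum.inl i) (mvEulerianHom (n + 1)) +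
              pderiv (Sum.inr i) (mvEulerianHom (n + 1)))).IsHomogeneous n :=
          IsHomogeneous.sum _ _ _ fun i _ => ih.pderiv.add ih.pderiv
        have h2 := ((isHomogeneous_X ℝ (Sum.inl (Fin.last (n + 1)) : Fin (n + 2) ⊕ Fin (n + 2))).mul
          (isHomogeneous_X ℝ (Sum.inr (Fin.last (n + 1)) : Fin (n + 2) ⊕ Fin (n + 2)))).mul
          (this.rename_isHomogeneous (f := Sum.map Fin.castSucc Fin.castSucc))
        convert h2 using 1
        ring

/-- The derivatives in `yᵢ` are lost once `yᵢ = 1`, but homogeneity recovers them: `∑ yᵢ∂/∂yᵢ`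
equals `n` minus the Euler operator in the `x` variables, and the factors `yᵢ` become `1`. -/
lemma bicoeff_planeHom_sum_pderiv_inr (δ : ℕ → ℝ) (n a b : ℕ) :
    bicoeff (planeHom δ n (∑ i, pderiv (Sum.inr i) (mvEulerianHom n))) a b =
      (n - a - b) * bicoeff (planeEulerian δ n) a b := by
  have h := (isHomogeneous_mvEulerianHom n).sum_X_mul_pderiv
  rw [Fintype.sum_sum_type] at h
  have h2 := congrArg (fun q => bicoeff (planeHom δ n q) a b) h
  simp only [map_add, bicoeff_add, bicoeff_planeHom_euler] at h2
  have h3 : planeHom δ n (∑ i, X (Sum.inr i) * pderiv (Sum.inr i) (mvEulerianHom n)) =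
      planeHom δ n (∑ i, pderiv (Sum.inr i) (mvEulerianHom n)) := by
    simp [planeHom_inr]
  have h4 : bicoeff (planeHom δ n (n • mvEulerianHom n)) a b =
      n * bicoeff (planeHom δ n (mvEulerianHom n)) a b := by
    rw [map_nsmul]; simp [bicoeff]
  rw [h3, h4] at h2
  rw [planeEulerian]
  linarith

/-- The polynomial `g` with `f_{n+1} = f_n + (s + δₙ t) g` for the restrictions `f_n` to planes. -/
def planeStep (δ : ℕ → ℝ) (n : ℕ) : Polynomial (Polynomial ℝ) :=
  planeEulerian δ n + Polynomial.derivative (planeEulerian δ n) +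
    planeHom δ n (∑ i, pderiv (Sum.inr i) (mvEulerianHom n))

lemma bicoeff_planeStep (δ : ℕ → ℝ) (n a b : ℕ) :
    bicoeff (planeStep δ n) a b =
      (n + 1 - a - b) * bicoeff (planeEulerian δ n) a b +
        (b + 1) * bicoeff (planeEulerian δ n) a (b + 1) := by
  rw [planeStep, bicoeff_add, bicoeff_add, bicoeff_derivative, bicoeff_planeHom_sum_pderiv_inr]
  ring

lemma planeEulerian_succ (δ : ℕ → ℝ) (n : ℕ) :
    planeEulerian δ (n + 1) = planeEulerian δ n + planeVar (δ n) * planeStep δ n := by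
  rw [planeEulerian, mvEulerianHom]
  simp only [map_add, map_mul, planeHom_rename, planeHom_inl, planeHom_inr, Fin.val_last,
    Finset.sum_add_distrib, planeHom_sum_pderiv_inl]
  rw [planeStep, planeEulerian]
  ring

/-- The coefficient of `tᵃ sᵇ` in the restriction of the `n`-th multivariate Eulerian polynomial
to the plane of the points `s (1, …, 1) + t δ`. -/
def planeCoeff (δ : ℕ → ℝ) (n a b : ℕ) : ℝ := bicoeff (planeEulerian δ n) a b

lemma planeCoeff_zero_eq (δ : ℕ → ℝ) (a b : ℕ) :
    planeCoeff δ 0 a b = if a = 0 ∧ b = 0 then 1 else 0 := by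
  simp only [planeCoeff, planeEulerian, mvEulerianHom, map_one, bicoeff, Polynomial.coeff_one]
  by_cases hb : b = 0 <;> by_cases ha : a = 0 <;> simp [ha, hb, Polynomial.coeff_one]

lemma planeCoeff_zero_zero (δ : ℕ → ℝ) (n : ℕ) : planeCoeff δ n 0 0 = 1 := by
  induction n with
  | zero => simp [planeCoeff_zero_eq]
  | succ n ih =>
    rw [planeCoeff, planeEulerian_succ, bicoeff_add, bicoeff_planeVar_mul_zero_zero, add_zero]
    exact ih

lemma planeCoeff_succ_zero_succ (δ : ℕ → ℝ) (n b : ℕ) :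
    planeCoeff δ (n + 1) 0 (b + 1) =
      (b + 2) * planeCoeff δ n 0 (b + 1) + (n + 1 - b) * planeCoeff δ n 0 b := by
  rw [planeCoeff, planeEulerian_succ, bicoeff_add, bicoeff_planeVar_mul_zero_succ,
    bicoeff_planeStep]
  simp only [planeCoeff, Nat.cast_zero]
  ring

lemma planeCoeff_succ_succ_zero (δ : ℕ → ℝ) (n a : ℕ) :
    planeCoeff δ (n + 1) (a + 1) 0 = planeCoeff δ n (a + 1) 0 +
      δ n * ((n + 1 - a) * planeCoeff δ n a 0 + planeCoeff δ n a 1) := by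
  rw [planeCoeff, planeEulerian_succ, bicoeff_add, bicoeff_planeVar_mul_succ_zero,
    bicoeff_planeStep]
  simp only [planeCoeff, Nat.cast_zero]
  ring

lemma planeCoeff_succ_succ_succ (δ : ℕ → ℝ) (n a b : ℕ) :
    planeCoeff δ (n + 1) (a + 1) (b + 1) =
      (b + 2) * planeCoeff δ n (a + 1) (b + 1) + (n - a - b) * planeCoeff δ n (a + 1) b +
      δ n * ((n - a - b) * planeCoeff δ n a (b + 1) + (b + 2) * planeCoeff δ n a (b + 2)) := by
  rw [planeCoeff, planeEulerian_succ, bicoeff_add, bicoeff_planeVar_mul_succ_succ,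
    bicoeff_planeStep, bicoeff_planeStep]
  simp only [planeCoeff, Nat.cast_succ]
  ring

/-! ### Coefficients on lines -/

lemma coeff_eval₂_eq_sum_bicoeff (s t : ℝ) (f : Polynomial (Polynomial ℝ)) (d : ℕ) :
    (Polynomial.eval₂ ((Polynomial.aeval (Polynomial.C t * Polynomial.X : Polynomial ℝ)).toRingHom)
      (Polynomial.C s * Polynomial.X) f).coeff d =
      ∑ k ∈ Finset.HasAntidiagonal.antidiagonal d, bicoeff f k.1 k.2 * t ^ k.1 * s ^ k.2 := by
  induction f using Polynomial.induction_on' with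
  | add p q hp hq =>
    simp only [Polynomial.eval₂_add, Polynomial.coeff_add, hp, hq, bicoeff_add, add_mul,
      Finset.sum_add_distrib]
  | monomial b g =>
    induction g using Polynomial.induction_on' with
    | add p q hp hq =>
      simp only [map_add, Polynomial.eval₂_add, Polynomial.coeff_add, hp, hq, bicoeff_add, add_mul,
        Finset.sum_add_distrib]
    | monomial a c =>
      have e : Polynomial.eval₂
          ((Polynomial.aeval (Polynomial.C t * Polynomial.X : Polynomial ℝ)).toRingHom)
          (Polynomial.C s * Polynomial.X) (Polynomial.monomial b (Polynomial.monomial a c)) =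
          Polynomial.C (c * t ^ a * s ^ b) * Polynomial.X ^ (a + b) := by
        rw [Polynomial.eval₂_monomial]
        simp [Polynomial.aeval_monomial, mul_pow, pow_add]
        ring
      have hk : ∀ k : ℕ × ℕ, bicoeff (Polynomial.monomial b (Polynomial.monomial a c)) k.1 k.2 =
          if k = (a, b) then c else 0 := by
        rintro ⟨k, l⟩
        simp only [bicoeff, Polynomial.coeff_monomial, Prod.mk.injEq]
        by_cases h1 : b = l <;> by_cases h2 : a = k <;>
          simp [h1, h2, Polynomial.coeff_monomial, eq_comm (a := k), eq_comm (a := l)]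
      rw [e, Polynomial.coeff_C_mul, Polynomial.coeff_X_pow]
      simp only [hk, ite_mul, zero_mul, Finset.sum_ite_eq', Finset.HasAntidiagonal.mem_antidiagonal]
      by_cases h : a + b = d
      · simp [h]
      · simp [h, Ne.symm h]

lemma coeff_lineRestrict_mvEulerian (δ : ℕ → ℝ) (n : ℕ) (s t : ℝ) (d : ℕ) :
    (lineRestrict (mvEulerian n) (fun i => s + t * δ i)).coeff d =
      ∑ k ∈ Finset.HasAntidiagonal.antidiagonal d, planeCoeff δ n k.1 k.2 * t ^ k.1 * s ^ k.2 := by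
  simp only [planeCoeff]
  rw [← coeff_eval₂_eq_sum_bicoeff]
  congr 1
  have : ((aeval (R := ℝ) (fun i => Polynomial.C (s + t * δ i) * Polynomial.X :
      Fin n → Polynomial ℝ)).comp (aeval (R := ℝ) (Sum.elim X (fun _ => 1)) :
        MvPolynomial (Fin n ⊕ Fin n) ℝ →ₐ[ℝ] MvPolynomial (Fin n) ℝ)).toRingHom =
      (Polynomial.eval₂RingHom
        ((Polynomial.aeval (Polynomial.C t * Polynomial.X : Polynomial ℝ)).toRingHom)
      (Polynomial.C s * Polynomial.X)).comp (planeHom δ n).toRingHom := by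
    apply MvPolynomial.ringHom_ext
    · intro r
      simp
    · rintro (i | i)
      · simp [planeHom_inl, planeVar]
        ring
      · simp [planeHom_inr]
  exact DFunLike.congr_fun this (mvEulerianHom n)

/-! ### Closed forms of the coefficients -/

/-- The coefficient of `x` in the `n`-th Eulerian polynomial. -/
def eulOne (n : ℕ) : ℝ := 2 ^ (n + 1) - n - 2

/-- The coefficient of `x²` in the `n`-th Eulerian polynomial. -/
def eulTwo (n : ℕ) : ℝ := 3 ^ (n + 1) - (n + 2) * 2 ^ (n + 1) + (n + 1) * (n + 2) / 2

/-- The coefficient of `x³` in the `n`-th Eulerian polynomial. -/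
def eulThree (n : ℕ) : ℝ :=
  4 ^ (n + 1) - (n + 2) * 3 ^ (n + 1) + (n + 1) * (n + 2) / 2 * 2 ^ (n + 1)
    - n * (n + 1) * (n + 2) / 6

lemma planeCoeff_zero_one (δ : ℕ → ℝ) (n : ℕ) : planeCoeff δ n 0 1 = eulOne n := by
  induction n with
  | zero => simp [planeCoeff_zero_eq, eulOne]
  | succ n ih =>
    rw [planeCoeff_succ_zero_succ, zero_add, ih, planeCoeff_zero_zero, eulOne, eulOne]
    push_cast; ring

lemma planeCoeff_zero_two (δ : ℕ → ℝ) (n : ℕ) : planeCoeff δ n 0 2 = eulTwo n := by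
  induction n with
  | zero => simp [planeCoeff_zero_eq, eulTwo]; norm_num
  | succ n ih =>
    rw [planeCoeff_succ_zero_succ, one_add_one_eq_two, ih, planeCoeff_zero_one, eulTwo, eulTwo,
      eulOne]
    push_cast; ring

lemma planeCoeff_zero_three (δ : ℕ → ℝ) (n : ℕ) : planeCoeff δ n 0 3 = eulThree n := by
  induction n with
  | zero => simp [planeCoeff_zero_eq, eulThree]; norm_num
  | succ n ih =>
    rw [planeCoeff_succ_zero_succ, show 2 + 1 = 3 from rfl, ih, planeCoeff_zero_two, eulThree,
      eulThree, eulTwo]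
    push_cast; ring

/-- The sum `∑_{i < n} δᵢ (2^(i+1) - 1)`. -/
def dirOne (δ : ℕ → ℝ) (n : ℕ) : ℝ := ∑ i ∈ Finset.range n, δ i * (2 ^ (i + 1) - 1)

/-- The sum `∑_{i < n} δᵢ 2^(n-i) (3^(i+1) - 2^(i+1))`. -/
def dirTwo (δ : ℕ → ℝ) (n : ℕ) : ℝ :=
  2 ^ n * ∑ i ∈ Finset.range n, δ i * ((3 ^ (i + 1) - 2 ^ (i + 1)) / 2 ^ i)

/-- The sum `∑_{i < n} δᵢ 3^(n-i) (4^(i+1) - 3^(i+1))`. -/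
def dirThree (δ : ℕ → ℝ) (n : ℕ) : ℝ :=
  3 ^ n * ∑ i ∈ Finset.range n, δ i * ((4 ^ (i + 1) - 3 ^ (i + 1)) / 3 ^ i)

lemma planeCoeff_one_zero (δ : ℕ → ℝ) (n : ℕ) : planeCoeff δ n 1 0 = dirOne δ n := by
  induction n with
  | zero => simp [planeCoeff_zero_eq, dirOne]
  | succ n ih =>
    rw [planeCoeff_succ_succ_zero, zero_add, ih, planeCoeff_zero_zero, planeCoeff_zero_one, dirOne,
      dirOne, Finset.sum_range_succ, eulOne]
    push_cast; ring

/-- The recursion has multiplier 2. Here `dirTwo` propagates the increments of exponential size, and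
`-(n + 1) dirOne` absorbs the inhomogeneous term `n f₁₀`. The next coefficient is analogous with
multiplier 3. -/
lemma planeCoeff_one_one (δ : ℕ → ℝ) (n : ℕ) :
    planeCoeff δ n 1 1 = dirTwo δ n - (n + 1) * dirOne δ n := by
  induction n with
  | zero => simp [planeCoeff_zero_eq, dirOne, dirTwo]
  | succ n ih =>
    have h := planeCoeff_succ_succ_succ δ n 0 0
    simp only [zero_add] at h
    rw [h, ih, planeCoeff_one_zero, planeCoeff_zero_one, planeCoeff_zero_two, dirTwo, dirTwo,
      dirOne, dirOne, Finset.sum_range_succ, Finset.sum_range_succ, eulOne, eulTwo]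
    push_cast
    field_simp
    ring

lemma planeCoeff_one_two (δ : ℕ → ℝ) (n : ℕ) :
    planeCoeff δ n 1 2 =
      dirThree δ n - (n + 1) * dirTwo δ n + n * (n + 1) / 2 * dirOne δ n := by
  induction n with
  | zero => simp [planeCoeff_zero_eq, dirOne, dirTwo, dirThree]
  | succ n ih =>
    have h := planeCoeff_succ_succ_succ δ n 0 1
    norm_num only at h
    rw [h, ih, planeCoeff_one_one, planeCoeff_zero_two, planeCoeff_zero_three, dirThree, dirThree,
      dirTwo, dirTwo, dirOne, dirOne, Finset.sum_range_succ, Finset.sum_range_succ,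
      Finset.sum_range_succ, eulTwo, eulThree]
    push_cast
    field_simp
    ring

/-- The second-order coefficients vanish or are only estimated below, so their recursions suffice
and no closed form is needed. -/
lemma planeCoeff_two_zero_succ (δ : ℕ → ℝ) (n : ℕ) :
    planeCoeff δ (n + 1) 2 0 = planeCoeff δ n 2 0 +
      δ n * (n * planeCoeff δ n 1 0 + planeCoeff δ n 1 1) := by
  have h := planeCoeff_succ_succ_zero δ n 1
  rw [h]; push_cast; ring

lemma planeCoeff_two_one_succ (δ : ℕ → ℝ) (n : ℕ) :
    planeCoeff δ (n + 1) 2 1 = 2 * planeCoeff δ n 2 1 + (n - 1) * planeCoeff δ n 2 0 +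
      δ n * ((n - 1) * planeCoeff δ n 1 1 + 2 * planeCoeff δ n 1 2) := by
  have h := planeCoeff_succ_succ_succ δ n 1 0
  simp only [zero_add, one_add_one_eq_two] at h
  rw [h]; push_cast; ring

lemma planeCoeff_zero_of_lt (δ : ℕ → ℝ) {n b : ℕ} (h : n < b) : planeCoeff δ n 0 b = 0 := by
  induction n generalizing b with
  | zero => simp [planeCoeff_zero_eq, h.ne']
  | succ n ih =>
    obtain ⟨b, rfl⟩ : ∃ c, b = c + 1 := ⟨b - 1, by omega⟩
    rw [planeCoeff_succ_zero_succ, ih (by omega), ih (by omega)]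
    ring

lemma planeCoeff_zero_self (δ : ℕ → ℝ) (n : ℕ) : planeCoeff δ n 0 n = 1 := by
  induction n with
  | zero => simp [planeCoeff_zero_eq]
  | succ n ih =>
    rw [planeCoeff_succ_zero_succ, planeCoeff_zero_of_lt δ (Nat.lt_succ_self n), ih]
    ring

lemma coeff_eulerian (δ : ℕ → ℝ) (n k : ℕ) : (eulerian n).coeff k = planeCoeff δ n 0 k := by
  induction n generalizing k with
  | zero => simp [eulerian, planeCoeff_zero_eq, Polynomial.coeff_one]
  | succ n ih =>
    rw [eulerian, sub_mul, one_mul, mul_assoc, Polynomial.coeff_add, Polynomial.coeff_sub,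
      Polynomial.coeff_C_mul, Polynomial.coeff_derivative, Polynomial.coeff_X_mul, ih]
    cases k with
    | zero => simp [planeCoeff_zero_zero]
    | succ k =>
      rw [Polynomial.coeff_X_mul, Polynomial.coeff_X_mul, Polynomial.coeff_derivative,
        Polynomial.coeff_X_mul, ih, planeCoeff_succ_zero_succ]
      push_cast; ring

/-! ### Degrees and constant terms -/

lemma constantCoeff_mvEulerian (n : ℕ) : constantCoeff (mvEulerian n) = 1 := by
  rw [← coeff_zero_lineRestrict (mvEulerian n) (fun i => 0 + 0 * (0 : ℕ → ℝ) i),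
    coeff_lineRestrict_mvEulerian]
  simp [planeCoeff_zero_zero]

lemma natDegree_lineRestrict_le {n : ℕ} (p : MvPolynomial (Fin n) ℝ) (u : Fin n → ℝ) :
    (lineRestrict p u).natDegree ≤ p.totalDegree := by
  have := aeval_natDegree_le p le_rfl (fun i => Polynomial.C (u i) * Polynomial.X)
    (n := 1) fun i => (Polynomial.natDegree_C_mul_le _ _).trans Polynomial.natDegree_X_le
  simpa [lineRestrict] using this

lemma totalDegree_mvEulerian (n : ℕ) : (mvEulerian n).totalDegree = n := by
  apply le_antisymm
  · rw [mvEulerian, aeval_def, eval₂_eq']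
    refine totalDegree_finsetSum_le fun d hd => ?_
    have hdeg : d.degree = n := by
      have := isHomogeneous_mvEulerianHom n (mem_support_iff.1 hd)
      rw [Finsupp.degree_eq_weight_one]
      exact this
    refine (totalDegree_mul _ _).trans ?_
    rw [algebraMap_eq, totalDegree_C, zero_add]
    refine (totalDegree_finsetProd _ _).trans ?_
    refine le_trans ?_ ((Finsupp.degree_eq_sum d).symm.trans hdeg).le
    refine Finset.sum_le_sum fun i _ => ?_
    refine (totalDegree_pow _ _).trans ?_
    rcases i with i | i <;> simp
  -- The degree is attained already on the diagonal, where the top coefficient is 1.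
  · have h : (lineRestrict (mvEulerian n) (fun i => 1 + 0 * (0 : ℕ → ℝ) i)).coeff n = 1 := by
      rw [coeff_lineRestrict_mvEulerian, Finset.sum_eq_single (0, n)]
      · simp [planeCoeff_zero_self]
      · rintro ⟨a, b⟩ hab hne
        have : a ≠ 0 := by
          rintro rfl
          simp at hab
          exact hne (by simp [hab])
        simp [this]
      · simp
    exact (Polynomial.le_natDegree_of_ne_zero (by rw [h]; exact one_ne_zero)).trans
      (natDegree_lineRestrict_le (mvEulerian n) _)

lemma lineRestrict_eulerianOne (n : ℕ) (u : Fin 1 → ℝ) :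
    lineRestrict (eulerianOne n) u = (eulerian n).comp (Polynomial.C (u 0) * Polynomial.X) := by
  rw [lineRestrict, eulerianOne, ← Polynomial.aeval_algHom_apply]
  simp [Polynomial.comp, Polynomial.aeval_def]

lemma coeff_lineRestrict_eulerianOne (n : ℕ) (u : Fin 1 → ℝ) (k : ℕ) :
    (lineRestrict (eulerianOne n) u).coeff k = planeCoeff 0 n 0 k * u 0 ^ k := by
  rw [lineRestrict_eulerianOne, Polynomial.comp_C_mul_X_coeff, coeff_eulerian 0]

lemma constantCoeff_eulerianOne (n : ℕ) : constantCoeff (eulerianOne n) = 1 := by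
  rw [← coeff_zero_lineRestrict (eulerianOne n) 0, coeff_lineRestrict_eulerianOne]
  simp [planeCoeff_zero_zero]

lemma natDegree_eulerian_le (n : ℕ) : (eulerian n).natDegree ≤ n := by
  rw [Polynomial.natDegree_le_iff_coeff_eq_zero]
  intro k hk
  rw [coeff_eulerian 0, planeCoeff_zero_of_lt 0 hk]

lemma totalDegree_eulerianOne (n : ℕ) : (eulerianOne n).totalDegree = n := by
  apply le_antisymm
  · rw [eulerianOne, Polynomial.aeval_eq_sum_range]
    refine totalDegree_finsetSum_le fun k hk => ?_
    refine (totalDegree_smul_le _ _).trans ((totalDegree_pow _ _).trans ?_)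
    have := natDegree_eulerian_le n
    have := Finset.mem_range.1 hk
    rw [totalDegree_X]
    omega
  · refine le_trans ?_ (natDegree_lineRestrict_le (eulerianOne n) 1)
    apply Polynomial.le_natDegree_of_ne_zero
    rw [coeff_lineRestrict_eulerianOne, planeCoeff_zero_self]
    simp

/-! ### The quadratic forms -/

lemma sum_mul_mold {n : ℕ} (y : ℝ) (u : Fin n → ℝ) :
    ∑ i, C ((Fin.cons y u : Fin (n + 1) → ℝ) i) * mold n i = C y + linForm u := by
  simp [Fin.sum_univ_succ, mold, linForm]

lemma dotProduct_mulVec_LForm {n : ℕ} (p q : MvPolynomial (Fin n) ℝ) (v : Fin (n + 1) → ℝ) :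
    v ⬝ᵥ (Matrix.of fun i j => LForm p (q * (mold n i * mold n j))).mulVec v =
      LForm p (q * (∑ i, C (v i) * mold n i) ^ 2) := by
  rw [sq, Finset.sum_mul_sum]
  simp only [dotProduct, Matrix.mulVec, Matrix.of_apply, Finset.mul_sum, map_sum]
  refine Finset.sum_congr rfl fun i _ => Finset.sum_congr rfl fun j _ => ?_
  have : q * (C (v i) * mold n i * (C (v j) * mold n j)) =
      (v i * v j) • (q * (mold n i * mold n j)) := by
    rw [smul_eq_C_mul, C_mul]; ring
  rw [this, map_smul, smul_eq_mul]
  ring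

lemma dotProduct_pencilConst {n : ℕ} (p : MvPolynomial (Fin n) ℝ) (y : ℝ) (u : Fin n → ℝ) :
    (Fin.cons y u : Fin (n + 1) → ℝ) ⬝ᵥ (pencilConst p).mulVec (Fin.cons y u) =
      LForm p ((C y + linForm u) ^ 2) := by
  have h := dotProduct_mulVec_LForm p 1 (Fin.cons y u)
  simp only [one_mul, sum_mul_mold] at h
  exact h

lemma dotProduct_pencilSum {n : ℕ} (p : MvPolynomial (Fin n) ℝ) (y : ℝ) (u : Fin n → ℝ) :
    (Fin.cons y u : Fin (n + 1) → ℝ) ⬝ᵥ (pencilSum p).mulVec (Fin.cons y u) =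
      LForm p (linForm 1 * (C y + linForm u) ^ 2) := by
  have h := dotProduct_mulVec_LForm p (linForm 1) (Fin.cons y u)
  rw [sum_mul_mold] at h
  rw [← h]
  congr 2
  ext i j
  simp [pencilSum, pencilCoeff, Matrix.sum_apply, linForm, Finset.sum_mul]

lemma LForm_sq {n : ℕ} (p : MvPolynomial (Fin n) ℝ) (hp : constantCoeff p = 1) (y : ℝ)
    (u : Fin n → ℝ) :
    LForm p ((C y + linForm u) ^ 2) = p.totalDegree * y ^ 2 + 2 * y * (lineRestrict p u).coeff 1 +
      ((lineRestrict p u).coeff 1 ^ 2 - 2 * (lineRestrict p u).coeff 2) := by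
  have e : (C y + linForm u) ^ 2 =
      y ^ 2 • (1 : MvPolynomial (Fin n) ℝ) + (2 * y) • linForm u + linForm u ^ 2 := by
    simp only [smul_eq_C_mul, C_mul, map_pow, map_ofNat]; ring
  rw [e, map_add, map_add, map_smul, map_smul, LForm_one, LForm_linForm p hp,
    LForm_linForm_sq p hp]
  simp only [smul_eq_mul]; ring

/-- Polarisation: products of linear forms are written through pure powers. The directions `u`, `u +
v`, `u - v`, `v` stay in one plane, and the weights are chosen so that the `v³` terms cancel. -/
lemma linForm_mul_sq_eq {n : ℕ} (y : ℝ) (u v : Fin n → ℝ) :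
    linForm u * (C y + linForm (u + v)) ^ 2 =
      y ^ 2 • linForm u + y • (linForm u ^ 2 + linForm (u + v) ^ 2 - linForm v ^ 2) +
      ((2 / 3 : ℝ) • linForm u ^ 3 + (1 / 2 : ℝ) • linForm (u + v) ^ 3
        - (1 / 6 : ℝ) • linForm (u - v) ^ 3 - (2 / 3 : ℝ) • linForm v ^ 3) := by
  have h6 : (C (1 / 6 : ℝ) : MvPolynomial (Fin n) ℝ) * 6 = 1 := by
    rw [← map_ofNat C 6, ← C_mul]; norm_num
  have h2 : (C (1 / 2 : ℝ) : MvPolynomial (Fin n) ℝ) = 3 * C (1 / 6 : ℝ) := by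
    rw [← map_ofNat C 3, ← C_mul]; norm_num
  have h3 : (C (2 / 3 : ℝ) : MvPolynomial (Fin n) ℝ) = 4 * C (1 / 6 : ℝ) := by
    rw [← map_ofNat C 4, ← C_mul]; norm_num
  simp only [smul_eq_C_mul, linForm_add, linForm_sub, map_pow, h2, h3]
  linear_combination
    (-(linForm u ^ 3 + 2 * linForm u ^ 2 * linForm v + linForm u * linForm v ^ 2)) * h6

/-- The value of `vᵀ A₀ v` for the multivariate Eulerian polynomial at `v = (y, 1 + δ)`. -/
def formD (δ : ℕ → ℝ) (n : ℕ) (y : ℝ) : ℝ :=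
  n * y ^ 2 + 2 * y * (eulOne n + planeCoeff δ n 1 0) +
    ((eulOne n + planeCoeff δ n 1 0) ^ 2 -
      2 * (eulTwo n + planeCoeff δ n 1 1 + planeCoeff δ n 2 0))

/-- The value of `vᵀ (A₁ + ⋯ + Aₙ) v` for the multivariate Eulerian polynomial at
`v = (y, 1 + δ)`. -/
def formN (δ : ℕ → ℝ) (n : ℕ) (y : ℝ) : ℝ :=
  eulOne n * y ^ 2 + 2 * y * (eulOne n * (eulOne n + planeCoeff δ n 1 0) -
    (2 * eulTwo n + planeCoeff δ n 1 1)) +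
  (eulOne n * (eulOne n + planeCoeff δ n 1 0) ^ 2 -
    eulOne n * (eulTwo n + planeCoeff δ n 1 1 + planeCoeff δ n 2 0) -
    (eulOne n + planeCoeff δ n 1 0) * (2 * eulTwo n + planeCoeff δ n 1 1) +
    3 * eulThree n + 2 * planeCoeff δ n 1 2 + planeCoeff δ n 2 1)

lemma coeff_one_lineRestrict_mvEulerian (δ : ℕ → ℝ) (n : ℕ) (s t : ℝ) :
    (lineRestrict (mvEulerian n) (fun i => s + t * δ i)).coeff 1 =
      s * eulOne n + t * planeCoeff δ n 1 0 := by
  rw [coeff_lineRestrict_mvEulerian]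
  simp [Finset.Nat.antidiagonal_succ, planeCoeff_zero_one]
  ring

lemma coeff_two_lineRestrict_mvEulerian (δ : ℕ → ℝ) (n : ℕ) (s t : ℝ) :
    (lineRestrict (mvEulerian n) (fun i => s + t * δ i)).coeff 2 =
      s ^ 2 * eulTwo n + s * t * planeCoeff δ n 1 1 + t ^ 2 * planeCoeff δ n 2 0 := by
  rw [coeff_lineRestrict_mvEulerian]
  simp [Finset.Nat.antidiagonal_succ, planeCoeff_zero_two]
  ring

lemma coeff_three_lineRestrict_mvEulerian (δ : ℕ → ℝ) (n : ℕ) (s t : ℝ) :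
    (lineRestrict (mvEulerian n) (fun i => s + t * δ i)).coeff 3 =
      s ^ 3 * eulThree n + s ^ 2 * t * planeCoeff δ n 1 2 + s * t ^ 2 * planeCoeff δ n 2 1 +
        t ^ 3 * planeCoeff δ n 3 0 := by
  rw [coeff_lineRestrict_mvEulerian]
  simp [Finset.Nat.antidiagonal_succ, planeCoeff_zero_three]
  ring

lemma LForm_mvEulerian_sq (δ : ℕ → ℝ) (n : ℕ) (y : ℝ) :
    LForm (mvEulerian n) ((C y + linForm (fun i => 1 + δ i)) ^ 2) = formD δ n y := by
  have e : (fun i : Fin n => 1 + δ i) = fun i : Fin n => 1 + 1 * δ i := by simp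
  rw [LForm_sq _ (constantCoeff_mvEulerian n), totalDegree_mvEulerian, e,
    coeff_one_lineRestrict_mvEulerian, coeff_two_lineRestrict_mvEulerian, formD]
  ring

lemma LForm_mvEulerian_mul_sq (δ : ℕ → ℝ) (n : ℕ) (y : ℝ) :
    LForm (mvEulerian n) (linForm 1 * (C y + linForm (fun i => 1 + δ i)) ^ 2) = formN δ n y := by
  have e : (fun i : Fin n => 1 + δ i) = 1 + (fun i : Fin n => δ i) := rfl
  rw [e, linForm_mul_sq_eq]
  have e0 : (1 : Fin n → ℝ) = fun i : Fin n => 1 + 0 * δ i := by ext; simp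
  have e1 : (1 : Fin n → ℝ) + (fun i : Fin n => δ i) = fun i : Fin n => 1 + 1 * δ i := by
    ext; simp
  have e2 : (1 : Fin n → ℝ) - (fun i : Fin n => δ i) = fun i : Fin n => 1 + (-1) * δ i := by
    ext; simp; ring
  have e3 : (fun i : Fin n => δ i) = fun i : Fin n => 0 + 1 * δ i := by ext; simp
  have hp := constantCoeff_mvEulerian n
  rw [e1, e2, e3, e0]
  simp only [map_add, map_sub, map_smul, smul_eq_mul, LForm_linForm _ hp, LForm_linForm_sq _ hp,
    LForm_linForm_cube _ hp, coeff_one_lineRestrict_mvEulerian, coeff_two_lineRestrict_mvEulerian,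
    coeff_three_lineRestrict_mvEulerian, formN]
  ring

/-! ### The defining quantities of the multivariate bound -/

/-- The deviation of the variable part of `newVec m` from the all-ones vector. -/
def newDir (m : ℕ) (j : ℕ) : ℝ :=
  (if j + 1 + 2 ≤ m then -(2 : ℝ) ^ (m - (j + 1 + 2))
    else if j + 1 + 1 = m then 0
    else if j + 1 = m then 1 / 2
    else 1) - 1

lemma newVec_eq (m : ℕ) (y : ℝ) :
    newVec m y = Fin.cons y (fun j : Fin (2 * m) => 1 + newDir m j) := by
  simp [newVec, newDir]

lemma newD_eq (m : ℕ) : newD m = formD (newDir m) (2 * m) (yVal (2 * m)) := by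
  rw [newD, vVec, newVec_eq, dotProduct_pencilConst, LForm_mvEulerian_sq]

lemma newN_eq (m : ℕ) : newN m = formN (newDir m) (2 * m) (yVal (2 * m)) := by
  rw [newN, vVec, newVec_eq, dotProduct_pencilSum, LForm_mvEulerian_mul_sq]

/-- The deviation of `(-1, 1, …, 1)` from the all-ones vector. -/
def oldDir (j : ℕ) : ℝ := if j = 0 then -2 else 0

/-- Quadratic forms do not see a global sign. After negation the vector differs from the all-ones
vector in a single variable entry, at the price of replacing `y` by `-y`. -/
lemma eval_oldVec (n : ℕ) (y : ℝ) :
    (fun i => (oldVec n i).eval y) = -(Fin.cons (-y) (fun j : Fin n => 1 + oldDir j)) := by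
  ext i
  refine Fin.cases ?_ (fun j => ?_) i
  · simp [oldVec]
  · by_cases h : (j : ℕ) = 0 <;> simp [oldVec, oldDir, h]; norm_num

lemma eval_dotProduct_mulVec {n : ℕ} (A : Matrix (Fin n) (Fin n) ℝ) (w : Fin n → Polynomial ℝ)
    (y : ℝ) :
    (w ⬝ᵥ (A.map Polynomial.C).mulVec w).eval y =
      (fun i => (w i).eval y) ⬝ᵥ A.mulVec (fun i => (w i).eval y) := by
  simp [dotProduct, Matrix.mulVec, Polynomial.eval_finsetSum]

lemma eval_oldD (n : ℕ) (y : ℝ) : (oldD n).eval y = formD oldDir n (-y) := by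
  rw [oldD, eval_dotProduct_mulVec, eval_oldVec, Matrix.mulVec_neg, neg_dotProduct_neg,
    dotProduct_pencilConst, LForm_mvEulerian_sq]

lemma eval_oldN (n : ℕ) (y : ℝ) : (oldN n).eval y = formN oldDir n (-y) := by
  rw [oldN, eval_dotProduct_mulVec, eval_oldVec, Matrix.mulVec_neg, neg_dotProduct_neg,
    dotProduct_pencilSum, LForm_mvEulerian_mul_sq]

lemma derivative_mul_sub_eq (a₂ a₁ a₀ b₂ b₁ b₀ : ℝ) (P Q : Polynomial ℝ)
    (hP : ∀ y, P.eval y = a₂ * y ^ 2 + a₁ * y + a₀)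
    (hQ : ∀ y, Q.eval y = b₂ * y ^ 2 + b₁ * y + b₀) :
    Polynomial.derivative P * Q - P * Polynomial.derivative Q =
      Polynomial.C (a₂ * b₁ - a₁ * b₂) * Polynomial.X ^ 2 +
      Polynomial.C (2 * (a₂ * b₀ - a₀ * b₂)) * Polynomial.X + Polynomial.C (a₁ * b₀ - a₀ * b₁) := by
  have h1 : P = Polynomial.C a₂ * Polynomial.X ^ 2 + Polynomial.C a₁ * Polynomial.X +
      Polynomial.C a₀ := Polynomial.funext fun y => by simp [hP]
  have h2 : Q = Polynomial.C b₂ * Polynomial.X ^ 2 + Polynomial.C b₁ * Polynomial.X +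
      Polynomial.C b₀ := Polynomial.funext fun y => by simp [hQ]
  rw [h1, h2]
  simp only [Polynomial.derivative_add, Polynomial.derivative_C_mul, Polynomial.derivative_X_pow,
    Polynomial.derivative_C, Polynomial.derivative_X, Polynomial.C_mul, Polynomial.C_sub]
  simp only [map_ofNat, Nat.cast_ofNat]
  ring

/-- The quadratic coefficient of the optimality condition for `(y, 1 + δ)`. -/
def optA (δ : ℕ → ℝ) (n : ℕ) : ℝ :=
  n * (eulOne n * (eulOne n + planeCoeff δ n 1 0) - (2 * eulTwo n + planeCoeff δ n 1 1)) -
    eulOne n * (eulOne n + planeCoeff δ n 1 0)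

/-- The linear coefficient of the optimality condition for `(y, 1 + δ)`. -/
def optB (δ : ℕ → ℝ) (n : ℕ) : ℝ := n * formN δ n 0 - eulOne n * formD δ n 0

/-- The constant coefficient of the optimality condition for `(y, 1 + δ)`. -/
def optC (δ : ℕ → ℝ) (n : ℕ) : ℝ :=
  formN δ n 0 * (eulOne n + planeCoeff δ n 1 0) -
    (eulOne n * (eulOne n + planeCoeff δ n 1 0) - (2 * eulTwo n + planeCoeff δ n 1 1)) *
      formD δ n 0

lemma critPoly_eq (n : ℕ) :
    critPoly n = Polynomial.C (2 * optA oldDir n) * Polynomial.X ^ 2 +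
      Polynomial.C (-2 * optB oldDir n) * Polynomial.X + Polynomial.C (2 * optC oldDir n) := by
  rw [critPoly, derivative_mul_sub_eq (eulOne n)
    (-2 * (eulOne n * (eulOne n + planeCoeff oldDir n 1 0) -
      (2 * eulTwo n + planeCoeff oldDir n 1 1))) (formN oldDir n 0) n
    (-2 * (eulOne n + planeCoeff oldDir n 1 0)) (formD oldDir n 0)
    (oldN n) (oldD n) (fun y => by rw [eval_oldN, formN, formN]; ring)
    (fun y => by rw [eval_oldD, formD, formD]; ring)]
  congr 2
  · congr 2; rw [optA]; ring
  · congr 2; rw [optB]; ring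
  · rw [optC]; ring

lemma critA_eq (n : ℕ) : critA n = 2 * optA oldDir n := by
  rw [critA, critPoly_eq]; simp [mul_assoc]

lemma critB_eq (n : ℕ) : critB n = -2 * optB oldDir n := by
  rw [critB, critPoly_eq]; simp [mul_assoc, Polynomial.coeff_X_pow, Polynomial.coeff_C]

lemma critC_eq (n : ℕ) : critC n = 2 * optC oldDir n := by
  rw [critC, critPoly_eq]; simp

/-- The root of `a y² + b y + c` closer to zero, if `a`, `b`, `c` are positive. -/
def smallRoot (a b c : ℝ) : ℝ := (-b + √(b ^ 2 - 4 * a * c)) / (2 * a)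

/-- The discriminant of the optimality condition for `(y, 1 + δ)`. -/
def optDisc (δ : ℕ → ℝ) (n : ℕ) : ℝ := optB δ n ^ 2 - 4 * optA δ n * optC δ n

lemma critDisc_eq (n : ℕ) : critDisc n = 4 * optDisc oldDir n := by
  rw [critDisc, critA_eq, critB_eq, critC_eq, optDisc]; ring

/-- The plus sign before `b` in `yVal` accounts for this negation: it turns the parameter for `(y,
1, -1, …, -1)` into the one for `(y, -1, 1, …, 1)`. -/
lemma yVal_eq (n : ℕ) :
    yVal n = smallRoot (optA oldDir n) (optB oldDir n) (optC oldDir n) := by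
  rw [yVal, critDisc_eq, critA_eq, critB_eq, smallRoot, ← optDisc,
    Real.sqrt_mul (by norm_num), show √(4 : ℝ) = 2 by
      rw [show (4 : ℝ) = 2 ^ 2 by norm_num, Real.sqrt_sq (by norm_num)],
    show -2 * optB oldDir n + 2 * √(optDisc oldDir n) =
      2 * (-optB oldDir n + √(optDisc oldDir n)) by ring,
    mul_div_mul_left _ _ two_ne_zero]

/-! ### The univariate bound -/

lemma planeCoeff_one_zero_of_zero (n : ℕ) : planeCoeff 0 n 1 0 = 0 := by
  simp [planeCoeff_one_zero, dirOne]

lemma planeCoeff_one_one_of_zero (n : ℕ) : planeCoeff 0 n 1 1 = 0 := by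
  simp [planeCoeff_one_one, dirOne, dirTwo]

lemma planeCoeff_one_two_of_zero (n : ℕ) : planeCoeff 0 n 1 2 = 0 := by
  simp [planeCoeff_one_two, dirOne, dirTwo, dirThree]

lemma planeCoeff_two_zero_of_zero (n : ℕ) : planeCoeff 0 n 2 0 = 0 := by
  induction n with
  | zero => simp [planeCoeff_zero_eq]
  | succ n ih => simp [planeCoeff_two_zero_succ, ih]

lemma planeCoeff_two_one_of_zero (n : ℕ) : planeCoeff 0 n 2 1 = 0 := by
  induction n with
  | zero => simp [planeCoeff_zero_eq]
  | succ n ih => simp [planeCoeff_two_one_succ, ih, planeCoeff_two_zero_of_zero]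

lemma formD_zero (n : ℕ) (y : ℝ) :
    formD 0 n y = n * y ^ 2 + 2 * y * eulOne n + (eulOne n ^ 2 - 2 * eulTwo n) := by
  simp [formD, planeCoeff_one_zero_of_zero, planeCoeff_one_one_of_zero,
    planeCoeff_two_zero_of_zero]

lemma formN_zero (n : ℕ) (y : ℝ) :
    formN 0 n y = eulOne n * y ^ 2 + 2 * y * (eulOne n ^ 2 - 2 * eulTwo n) +
      (eulOne n ^ 3 - 3 * eulOne n * eulTwo n + 3 * eulThree n) := by
  simp only [formN, planeCoeff_one_zero_of_zero, planeCoeff_one_one_of_zero,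
    planeCoeff_two_zero_of_zero, planeCoeff_one_two_of_zero, planeCoeff_two_one_of_zero]
  ring

lemma isHermitian_pencil {n : ℕ} (p : MvPolynomial (Fin n) ℝ) (a : Fin n → ℝ) :
    (pencil p a).IsHermitian := by
  ext i j
  simp [pencil, pencilConst, pencilCoeff, Matrix.sum_apply, mul_comm (mold n i)]

lemma dotProduct_pencil_eulerianOne (n : ℕ) (x a b : ℝ) :
    (Fin.cons a (fun _ => b) : Fin 2 → ℝ) ⬝ᵥ
        (pencil (eulerianOne n) (fun _ => x)).mulVec (Fin.cons a (fun _ => b)) =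
      n * a ^ 2 + 2 * a * b * eulOne n + b ^ 2 * (eulOne n ^ 2 - 2 * eulTwo n) +
      x * (eulOne n * a ^ 2 + 2 * a * b * (eulOne n ^ 2 - 2 * eulTwo n) +
        b ^ 2 * (eulOne n ^ 3 - 3 * eulOne n * eulTwo n + 3 * eulThree n)) := by
  have h : pencil (eulerianOne n) (fun _ => x) =
      pencilConst (eulerianOne n) + x • pencilSum (eulerianOne n) := by
    rw [pencil, pencilSum, Finset.smul_sum]
  have hp := constantCoeff_eulerianOne n
  have hl : linForm (fun _ : Fin 1 => b) = b • linForm (1 : Fin 1 → ℝ) := by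
    simp [linForm, smul_eq_C_mul]
  have e : linForm (1 : Fin 1 → ℝ) * (C a + linForm (fun _ => b)) ^ 2 =
      a ^ 2 • linForm 1 + (2 * a * b) • linForm 1 ^ 2 + b ^ 2 • linForm 1 ^ 3 := by
    rw [hl]
    simp only [smul_eq_C_mul, C_mul, map_pow, map_ofNat]
    ring
  rw [h, Matrix.add_mulVec, dotProduct_add, Matrix.smul_mulVec, dotProduct_smul,
    dotProduct_pencilConst, dotProduct_pencilSum, e, LForm_sq _ hp, totalDegree_eulerianOne]
  simp only [map_add, map_smul, smul_eq_mul, LForm_linForm _ hp, LForm_linForm_sq _ hp,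
    LForm_linForm_cube _ hp, coeff_lineRestrict_eulerianOne, planeCoeff_zero_one,
    planeCoeff_zero_two, planeCoeff_zero_three, Pi.one_apply]
  ring

/-- At a stationary `y` with quotient `x = N/D`, the vector `(y, 1)` lies in the kernel of `A₀ -
x⁻¹A₁`. This 2×2 matrix is then a multiple of a rank-one square, nonnegative by `hle`, so `-x⁻¹`
belongs to the spectrahedron. Testing with `(y, 1)` shows that nothing smaller does. -/
lemma unBound_eq (n : ℕ) (y : ℝ)
    (hy : optA 0 n * y ^ 2 + optB 0 n * y + optC 0 n = 0)
    (hD : 0 < formD 0 n y) (hN : 0 < formN 0 n y)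
    (hle : eulOne n ≤ n * (formN 0 n y / formD 0 n y)) :
    unBound n = formN 0 n y / formD 0 n y := by
  set x := formN 0 n y / formD 0 n y with hx
  have hx0 : 0 < x := div_pos hN hD
  have hxD : x * formD 0 n y = formN 0 n y := div_mul_cancel₀ _ hD.ne'
  -- First row of the kernel equation `(xA₀ - A₁)(y, 1)ᵀ = 0`, equivalent to stationarity.
  have h1 : x * (n * y + eulOne n) = eulOne n * y + (eulOne n ^ 2 - 2 * eulTwo n) := by
    rw [hx, div_mul_eq_mul_div, div_eq_iff hD.ne']
    rw [optA, optB, optC] at hy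
    simp only [formD_zero, formN_zero, planeCoeff_one_zero_of_zero,
      planeCoeff_one_one_of_zero] at hy ⊢
    linear_combination hy
  -- Second row: the value of the form at `(y, 1)`, which is zero, minus `y` times the first row.
  have h2 : (x * eulOne n - (eulOne n ^ 2 - 2 * eulTwo n)) * y +
      (x * (eulOne n ^ 2 - 2 * eulTwo n) -
        (eulOne n ^ 3 - 3 * eulOne n * eulTwo n + 3 * eulThree n)) = 0 := by
    rw [formD_zero, formN_zero] at hxD
    linear_combination hxD - y * h1
  have hleast : IsLeast {z : ℝ | (fun _ => z) ∈ spectrahedron (eulerianOne n)} (-x⁻¹) := by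
    constructor
    · refine Matrix.PosSemidef.of_dotProduct_mulVec_nonneg (isHermitian_pencil _ _) fun v => ?_
      have hv : v = Fin.cons (v 0) (fun _ => v 1) := by
        ext i; fin_cases i <;> rfl
      rw [star_trivial, hv, dotProduct_pencil_eulerianOne]
      have : n * v 0 ^ 2 + 2 * v 0 * v 1 * eulOne n + v 1 ^ 2 * (eulOne n ^ 2 - 2 * eulTwo n) +
          -x⁻¹ * (eulOne n * v 0 ^ 2 + 2 * v 0 * v 1 * (eulOne n ^ 2 - 2 * eulTwo n) +
          v 1 ^ 2 * (eulOne n ^ 3 - 3 * eulOne n * eulTwo n + 3 * eulThree n)) =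
          x⁻¹ * ((n * x - eulOne n) * (v 0 - y * v 1) ^ 2) := by
        field_simp
        linear_combination (2 * v 0 * v 1 - y * v 1 ^ 2) * h1 + v 1 ^ 2 * h2
      rw [this]
      have : 0 ≤ n * x - eulOne n := by linarith
      positivity
    · intro z hz
      have hz' : (pencil (eulerianOne n) (fun _ => z)).PosSemidef := hz
      have h := hz'.dotProduct_mulVec_nonneg (Fin.cons y (fun _ => 1))
      rw [star_trivial, dotProduct_pencil_eulerianOne] at h
      have h3 : 0 ≤ formD 0 n y + z * formN 0 n y := by
        rw [formD_zero, formN_zero]; linarith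
      rw [← hxD] at h3
      have h4 : 0 ≤ formD 0 n y * (1 + z * x) := by linarith
      have h5 : 0 ≤ 1 + z * x := by
        by_contra hneg
        push Not at hneg
        exact absurd h4 (not_le.2 (mul_neg_of_pos_of_neg hD hneg))
      have h6 : x⁻¹ * x = 1 := inv_mul_cancel₀ hx0.ne'
      by_contra hlt
      push Not at hlt
      nlinarith
  rw [unBound, hleast.csInf_eq, inv_neg, neg_neg, inv_inv]

open Filter Topology Asymptotics

/-! ### Exponential growth up to polynomial factors -/

/-- `f m` is bounded by `rᵐ` up to a polynomial factor. -/
def SoftO (r : ℝ) (f : ℕ → ℝ) : Prop :=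
  0 ≤ r ∧ ∃ j : ℕ, f =O[atTop] fun m : ℕ => (m : ℝ) ^ j * r ^ m

lemma SoftO.mul {r s : ℝ} {f g : ℕ → ℝ} (hf : SoftO r f) (hg : SoftO s g) :
    SoftO (r * s) (fun m => f m * g m) := by
  obtain ⟨hr, j, hf⟩ := hf
  obtain ⟨hs, k, hg⟩ := hg
  refine ⟨mul_nonneg hr hs, j + k, (hf.mul hg).congr_right fun m => ?_⟩
  rw [mul_pow, pow_add]; ring

lemma isBigO_natCast_pow_mul_pow {r s : ℝ} {j k : ℕ} (hr : 0 ≤ r) (hrs : r ≤ s) (hjk : j ≤ k) :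
    (fun m : ℕ => (m : ℝ) ^ j * r ^ m) =O[atTop] fun m : ℕ => (m : ℝ) ^ k * s ^ m := by
  refine IsBigO.of_bound 1 ?_
  filter_upwards [eventually_ge_atTop 1] with m hm
  have hm' : (1 : ℝ) ≤ m := by exact_mod_cast hm
  rw [Real.norm_of_nonneg (by positivity), Real.norm_of_nonneg
    (mul_nonneg (by positivity) (pow_nonneg (hr.trans hrs) _)), one_mul]
  gcongr

lemma SoftO.mono {r s : ℝ} {f : ℕ → ℝ} (hf : SoftO r f) (hrs : r ≤ s) : SoftO s f := by
  obtain ⟨hr, j, hf⟩ := hf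
  exact ⟨hr.trans hrs, j, hf.trans (isBigO_natCast_pow_mul_pow hr hrs le_rfl)⟩

lemma SoftO.add {r : ℝ} {f g : ℕ → ℝ} (hf : SoftO r f) (hg : SoftO r g) :
    SoftO r (fun m => f m + g m) := by
  obtain ⟨hr, j, hf⟩ := hf
  obtain ⟨-, k, hg⟩ := hg
  exact ⟨hr, max j k,
    (hf.trans (isBigO_natCast_pow_mul_pow hr le_rfl (le_max_left _ _))).add
      (hg.trans (isBigO_natCast_pow_mul_pow hr le_rfl (le_max_right _ _)))⟩

lemma SoftO.neg {r : ℝ} {f : ℕ → ℝ} (hf : SoftO r f) : SoftO r (fun m => -f m) :=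
  ⟨hf.1, hf.2.imp fun _ h => h.neg_left⟩

lemma SoftO.sub {r : ℝ} {f g : ℕ → ℝ} (hf : SoftO r f) (hg : SoftO r g) :
    SoftO r (fun m => f m - g m) := by
  simpa only [sub_eq_add_neg] using hf.add hg.neg

lemma SoftO.congr {r : ℝ} {f g : ℕ → ℝ} (hf : SoftO r f) (h : ∀ᶠ m in atTop, f m = g m) :
    SoftO r g :=
  ⟨hf.1, hf.2.imp fun _ h' => h'.congr' h EventuallyEq.rfl⟩

lemma SoftO.of_abs_le {r : ℝ} {f g : ℕ → ℝ} (hg : SoftO r g)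
    (h : ∀ᶠ m in atTop, |f m| ≤ |g m|) : SoftO r f :=
  ⟨hg.1, hg.2.imp fun _ h' => (IsBigO.of_bound 1 (by simpa using h)).trans h'⟩

lemma softO_pow {r : ℝ} (hr : 0 ≤ r) : SoftO r (fun m => r ^ m) :=
  ⟨hr, 0, by simpa using isBigO_refl _ _⟩

lemma softO_const (c : ℝ) : SoftO 1 (fun _ => c) :=
  ⟨zero_le_one, 0, by simpa using isBigO_const_const c (one_ne_zero (α := ℝ)) atTop⟩

lemma softO_natCast : SoftO 1 (fun m => (m : ℝ)) :=
  ⟨zero_le_one, 1, by simpa using isBigO_refl _ _⟩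

lemma softO_two_mul : SoftO 1 (fun m => ((2 * m : ℕ) : ℝ)) := by
  have := (softO_const 2).mul softO_natCast
  simpa using this

lemma SoftO.const_mul {r : ℝ} {f : ℕ → ℝ} (hf : SoftO r f) (c : ℝ) :
    SoftO r (fun m => c * f m) := by
  simpa using (softO_const c).mul hf

lemma SoftO.tendsto_div {r s : ℝ} {f : ℕ → ℝ} (hf : SoftO r f) (hrs : r < s) :
    Tendsto (fun m => f m / s ^ m) atTop (𝓝 0) := by
  obtain ⟨hr, j, hf⟩ := hf
  have hs : 0 < s := hr.trans_lt hrs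
  have h := (hf.mul (isBigO_refl (fun m : ℕ => (s ^ m)⁻¹) atTop)).trans_tendsto ?_
  · simpa [div_eq_mul_inv] using h
  · have h2 := tendsto_pow_const_mul_const_pow_of_abs_lt_one j (r := r / s)
      (by rw [abs_of_nonneg (by positivity), div_lt_one hs]; exact hrs)
    refine h2.congr fun m => ?_
    rw [div_pow, div_eq_mul_inv, mul_assoc]

lemma SoftO.of_tendsto {r c : ℝ} {f : ℕ → ℝ} (hr : 0 < r)
    (h : Tendsto (fun m => f m / r ^ m) atTop (𝓝 c)) : SoftO r f := by
  refine ⟨hr.le, 0, ?_⟩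
  have := (h.isBigO_one ℝ).mul (isBigO_refl (fun m : ℕ => r ^ m) atTop)
  refine (this.congr_left fun m => ?_).congr_right fun m => ?_
  · exact div_mul_cancel₀ _ (pow_pos hr m).ne'
  · simp

lemma tendsto_div_of_softO_sub {r s c : ℝ} {f : ℕ → ℝ} (hs : 0 < s) (hrs : r < s)
    (h : SoftO r (fun m => f m - c * s ^ m)) :
    Tendsto (fun m => f m / s ^ m) atTop (𝓝 c) := by
  have h2 := (h.tendsto_div hrs).add_const c
  rw [zero_add] at h2
  refine h2.congr fun m => ?_
  have := (pow_pos hs m).ne'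
  field_simp
  ring

/-! ### Growth of the Eulerian numbers -/

lemma softO_eulOne_sub : SoftO 1 (fun m => eulOne (2 * m) - 2 * 4 ^ m) := by
  refine ((softO_two_mul.add (softO_const 2)).neg).congr (Eventually.of_forall fun m => ?_)
  rw [eulOne, pow_succ, pow_mul]; norm_num; ring

lemma tendsto_eulOne : Tendsto (fun m => eulOne (2 * m) / 4 ^ m) atTop (𝓝 2) :=
  tendsto_div_of_softO_sub (by norm_num) (by norm_num) softO_eulOne_sub

lemma softO_eulTwo_sub : SoftO 4 (fun m => eulTwo (2 * m) - 3 * 9 ^ m) := by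
  have hN := softO_two_mul
  have h1 := ((hN.add (softO_const 2)).mul (softO_pow (r := 4) (by norm_num))).const_mul (-2)
  have h2 := ((hN.add (softO_const 1)).mul (hN.add (softO_const 2))).const_mul (1 / 2)
  refine ((h1.mono (s := 4) (by norm_num)).add (h2.mono (by norm_num))).congr
    (Eventually.of_forall fun m => ?_)
  rw [eulTwo, pow_succ, pow_mul, pow_succ 2, pow_mul 2]; norm_num; ring

lemma tendsto_eulTwo : Tendsto (fun m => eulTwo (2 * m) / 9 ^ m) atTop (𝓝 3) :=
  tendsto_div_of_softO_sub (by norm_num) (by norm_num) softO_eulTwo_sub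

lemma tendsto_eulThree : Tendsto (fun m => eulThree (2 * m) / 16 ^ m) atTop (𝓝 4) := by
  refine tendsto_div_of_softO_sub (r := 9) (by norm_num) (by norm_num) ?_
  have hN := softO_two_mul
  have h1 := ((hN.add (softO_const 2)).mul (softO_pow (r := 9) (by norm_num))).const_mul (-3)
  have h2 := ((hN.add (softO_const 1)).mul (hN.add (softO_const 2))).mul
    (softO_pow (r := 4) (by norm_num))
  have h3 := ((hN.mul (hN.add (softO_const 1))).mul (hN.add (softO_const 2))).const_mul (-1 / 6)
  refine (((h1.mono (s := 9) (by norm_num)).add (h2.mono (by norm_num))).add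
    (h3.mono (by norm_num))).congr (Eventually.of_forall fun m => ?_)
  rw [eulThree, pow_succ 4, pow_mul 4, pow_succ 3, pow_mul 3, pow_succ 2, pow_mul 2]; norm_num; ring

lemma softO_eulOne : SoftO 4 (fun m => eulOne (2 * m)) :=
  .of_tendsto (by norm_num) tendsto_eulOne

lemma softO_eulTwo : SoftO 9 (fun m => eulTwo (2 * m)) :=
  .of_tendsto (by norm_num) tendsto_eulTwo

lemma softO_eulThree : SoftO 16 (fun m => eulThree (2 * m)) :=
  .of_tendsto (by norm_num) tendsto_eulThree

/-! ### The direction of the new vector -/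

/-- One envelope for all blocks: it is the dominating sequence for Tannery's theorem, and its decay
`2^(-i)` offsets the growth of the lower coefficients in the recursions. -/
lemma abs_newDir_le (m i : ℕ) : |newDir m i| ≤ 2 ^ m / 2 ^ (i + 1) := by
  rw [le_div_iff₀ (by positivity), newDir]
  split_ifs with h1 h2 h3
  · obtain ⟨k, rfl⟩ : ∃ k, m = k + (i + 3) := ⟨m - (i + 3), by omega⟩
    have hk : k + (i + 3) - (i + 1 + 2) = k := by omega
    rw [hk, abs_of_nonpos (by linarith [pow_pos (two_pos (α := ℝ)) k]), pow_add (2 : ℝ) k,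
      pow_succ (2 : ℝ) i, pow_add (2 : ℝ) i 3]
    have h1 : (1 : ℝ) ≤ 2 ^ k := one_le_pow₀ (by norm_num)
    have h2 : (0 : ℝ) < 2 ^ i := by positivity
    nlinarith
  · rw [← h2, pow_succ (2 : ℝ) (i + 1)]
    have h2 : (0 : ℝ) < 2 ^ (i + 1) := by positivity
    norm_num
  · rw [← h3]
    have h2 : (0 : ℝ) < 2 ^ (i + 1) := by positivity
    rw [show |(1 / 2 : ℝ) - 1| = 1 / 2 by norm_num [abs_of_neg]]
    linarith
  · simp

lemma newDir_eq_zero {m i : ℕ} (h : m ≤ i) : newDir m i = 0 := by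
  rw [newDir, if_neg (by omega), if_neg (by omega), if_neg (by omega), sub_self]

lemma tendsto_newDir (i : ℕ) :
    Tendsto (fun m => newDir m i / 2 ^ m) atTop (𝓝 (-(1 / 8) * (1 / 2) ^ i)) := by
  have h : Tendsto (fun m : ℕ => -(1 / 8) * (1 / 2 : ℝ) ^ i - (1 / 2) ^ m) atTop
      (𝓝 (-(1 / 8) * (1 / 2) ^ i - 0)) :=
    (tendsto_pow_atTop_nhds_zero_of_lt_one (by norm_num) (by norm_num)).const_sub _
  rw [sub_zero] at h
  refine h.congr' ?_
  filter_upwards [eventually_ge_atTop (i + 3)] with m hm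
  obtain ⟨k, rfl⟩ : ∃ k, m = k + (i + 3) := ⟨m - (i + 3), by omega⟩
  have hk : k + (i + 3) - (i + 1 + 2) = k := by omega
  rw [newDir, if_pos (by omega), hk]
  simp only [one_div, inv_pow, pow_add]
  field_simp
  ring

/-- Tannery's theorem for sums against the direction of the new vector. -/
lemma tendsto_sum_newDir_mul (w : ℕ → ℝ) (hw : Summable fun i => |w i| / 2 ^ (i + 1)) {L : ℝ}
    (hL : HasSum (fun i => -(1 / 8) * (1 / 2) ^ i * w i) L) :
    Tendsto (fun m => (∑ i ∈ Finset.range (2 * m), newDir m i * w i) / 2 ^ m) atTop (𝓝 L) := by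
  rw [← hL.tsum_eq]
  have h := tendsto_tsum_of_dominated_convergence (𝓕 := atTop)
    (f := fun (m : ℕ) (i : ℕ) => newDir m i / 2 ^ m * w i) hw
    (fun i => (tendsto_newDir i).mul_const (w i)) ?_
  · refine h.congr fun m => ?_
    rw [tsum_eq_sum (s := Finset.range (2 * m)), Finset.sum_div]
    · refine Finset.sum_congr rfl fun i _ => ?_
      ring
    · intro i hi
      rw [newDir_eq_zero (by simp at hi; omega)]
      simp
  · refine Eventually.of_forall fun m i => ?_
    rw [norm_mul, norm_div, Real.norm_eq_abs, Real.norm_eq_abs, Real.norm_eq_abs,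
      abs_of_pos (pow_pos (two_pos (α := ℝ)) m), div_mul_eq_mul_div, div_le_div_iff₀ (by positivity)
      (by positivity)]
    have := abs_newDir_le m i
    rw [le_div_iff₀ (by positivity)] at this
    nlinarith [abs_nonneg (w i)]

/-- The limiting series is `-(3/8)∑(3/4)^i + (1/4)∑(1/2)^i = -3/2 + 1/2`. -/
lemma tendsto_dirTwo_newDir :
    Tendsto (fun m => dirTwo (newDir m) (2 * m) / 8 ^ m) atTop (𝓝 (-1)) := by
  have h := tendsto_sum_newDir_mul (fun i => (3 ^ (i + 1) - 2 ^ (i + 1)) / 2 ^ i) (L := -1) ?_ ?_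
  · refine h.congr fun m => ?_
    rw [dirTwo, pow_mul, show (8 : ℝ) = 2 ^ 2 * 2 by norm_num, mul_pow]
    field_simp
  · refine Summable.of_nonneg_of_le (fun i => by positivity) (fun i => ?_)
      ((summable_geometric_of_lt_one (r := 3 / 4) (by norm_num) (by norm_num)).mul_left (3 / 2))
    have h1 : (2 : ℝ) ^ (i + 1) ≤ 3 ^ (i + 1) := by gcongr; norm_num
    rw [abs_of_nonneg (by apply div_nonneg; linarith; positivity), div_div,
      div_le_iff₀ (by positivity), div_pow, show (4 : ℝ) = 2 * 2 by norm_num, mul_pow]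
    field_simp
    have h2 : (0 : ℝ) < 2 ^ (i + 1) := by positivity
    rw [pow_succ (3 : ℝ)]
    rw [pow_succ (2 : ℝ)] at h2 ⊢
    nlinarith
  · have h1 := (hasSum_geometric_of_lt_one (r := (3 / 4 : ℝ)) (by norm_num) (by norm_num)).mul_left
      (-(3 / 8))
    have h2 := (hasSum_geometric_of_lt_one (r := (1 / 2 : ℝ)) (by norm_num) (by norm_num)).mul_left
      (1 / 4)
    convert! h1.add h2 using 1
    · ext i
      rw [div_pow, div_pow, show (4 : ℝ) = 2 * 2 by norm_num, mul_pow]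
      field_simp
      ring
    · norm_num

/-- The limiting series is `-(1/2)∑(2/3)^i + (3/8)∑(1/2)^i = -3/2 + 3/4`. -/
lemma tendsto_dirThree_newDir :
    Tendsto (fun m => dirThree (newDir m) (2 * m) / 18 ^ m) atTop (𝓝 (-(3 / 4))) := by
  have h := tendsto_sum_newDir_mul (fun i => (4 ^ (i + 1) - 3 ^ (i + 1)) / 3 ^ i)
    (L := -(3 / 4)) ?_ ?_
  · refine h.congr fun m => ?_
    rw [dirThree, pow_mul, show (18 : ℝ) = 3 ^ 2 * 2 by norm_num, mul_pow]
    field_simp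
  · refine Summable.of_nonneg_of_le (fun i => by positivity) (fun i => ?_)
      ((summable_geometric_of_lt_one (r := 2 / 3) (by norm_num) (by norm_num)).mul_left 2)
    have h1 : (3 : ℝ) ^ (i + 1) ≤ 4 ^ (i + 1) := by gcongr; norm_num
    rw [abs_of_nonneg (by apply div_nonneg; linarith; positivity), div_div,
      div_le_iff₀ (by positivity), div_pow]
    field_simp
    have h2 : (0 : ℝ) < 3 ^ (i + 1) := by positivity
    rw [show (4 : ℝ) = 2 * 2 by norm_num, mul_pow, pow_succ (2 : ℝ)]
    nlinarith
  · have h1 := (hasSum_geometric_of_lt_one (r := (2 / 3 : ℝ)) (by norm_num) (by norm_num)).mul_left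
      (-(1 / 2))
    have h2 := (hasSum_geometric_of_lt_one (r := (1 / 2 : ℝ)) (by norm_num) (by norm_num)).mul_left
      (3 / 8)
    convert! h1.add h2 using 1
    · ext i
      rw [div_pow, div_pow, show (4 : ℝ) = 2 * 2 by norm_num, mul_pow]
      field_simp
      ring
    · norm_num

/-- The weights `2^(i+1) - 1` exactly undo the decay of `newDir`, so there is no summable majorant;
each of the `n` terms is just bounded by `2^m`. -/
lemma abs_dirOne_newDir_le (m n : ℕ) : |dirOne (newDir m) n| ≤ n * 2 ^ m := by
  refine (Finset.abs_sum_le_sum_abs _ _).trans ?_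
  rw [← nsmul_eq_mul]
  conv_rhs => rw [← Finset.card_range n]
  refine Finset.sum_le_card_nsmul _ _ _ fun i _ => ?_
  have h := abs_newDir_le m i
  rw [le_div_iff₀ (by positivity)] at h
  have h1 : (1 : ℝ) ≤ 2 ^ (i + 1) := one_le_pow₀ (by norm_num)
  rw [abs_mul, abs_of_nonneg (by linarith : (0 : ℝ) ≤ 2 ^ (i + 1) - 1)]
  nlinarith [abs_nonneg (newDir m i)]

/-- Unlike the limits at `n = 2m`, this holds for every `n`, as the inductions for the second-order
coefficients require. -/
lemma abs_dirTwo_newDir_le (m n : ℕ) : |dirTwo (newDir m) n| ≤ 2 ^ n * (n * (2 * 2 ^ m)) := by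
  rw [dirTwo, abs_mul, abs_of_pos (by positivity)]
  refine mul_le_mul_of_nonneg_left ?_ (by positivity)
  refine (Finset.abs_sum_le_sum_abs _ _).trans ?_
  rw [← nsmul_eq_mul]
  conv_rhs => rw [← Finset.card_range n]
  refine Finset.sum_le_card_nsmul _ _ _ fun i _ => ?_
  have h := abs_newDir_le m i
  rw [le_div_iff₀ (by positivity)] at h
  have h1 : (2 : ℝ) ^ (i + 1) ≤ 3 ^ (i + 1) := by gcongr; norm_num
  have h2 : (3 : ℝ) ^ (i + 1) ≤ 4 ^ (i + 1) := by gcongr; norm_num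
  have h3 : (4 : ℝ) ^ (i + 1) = 2 ^ (i + 1) * (2 * 2 ^ i) := by
    rw [show (4 : ℝ) = 2 * 2 by norm_num, mul_pow, pow_succ (2 : ℝ) i]; ring
  rw [abs_mul, abs_of_nonneg (div_nonneg (sub_nonneg.2 h1) (by positivity)), ← mul_div_assoc,
    div_le_iff₀ (by positivity)]
  calc |newDir m i| * (3 ^ (i + 1) - 2 ^ (i + 1)) ≤ |newDir m i| * 4 ^ (i + 1) := by
        gcongr
        linarith [pow_pos (two_pos (α := ℝ)) (i + 1)]
    _ = (|newDir m i| * 2 ^ (i + 1)) * (2 * 2 ^ i) := by rw [h3]; ring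
    _ ≤ 2 ^ m * (2 * 2 ^ i) := by gcongr
    _ = 2 * 2 ^ m * 2 ^ i := by ring

lemma abs_dirThree_newDir_le (m n : ℕ) : |dirThree (newDir m) n| ≤ 3 ^ n * (n * (3 * 2 ^ m)) := by
  rw [dirThree, abs_mul, abs_of_pos (by positivity)]
  refine mul_le_mul_of_nonneg_left ?_ (by positivity)
  refine (Finset.abs_sum_le_sum_abs _ _).trans ?_
  rw [← nsmul_eq_mul]
  conv_rhs => rw [← Finset.card_range n]
  refine Finset.sum_le_card_nsmul _ _ _ fun i _ => ?_
  have h := abs_newDir_le m i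
  rw [le_div_iff₀ (by positivity)] at h
  have h1 : (3 : ℝ) ^ (i + 1) ≤ 4 ^ (i + 1) := by gcongr; norm_num
  -- Base `6 = 2·3` splits into the decay rate of `newDir` and the denominator `3^i`.
  have h2 : (4 : ℝ) ^ (i + 1) ≤ 6 ^ (i + 1) := by gcongr; norm_num
  have h3 : (6 : ℝ) ^ (i + 1) = 2 ^ (i + 1) * (3 * 3 ^ i) := by
    rw [show (6 : ℝ) = 2 * 3 by norm_num, mul_pow, pow_succ (3 : ℝ) i]; ring
  rw [abs_mul, abs_of_nonneg (div_nonneg (sub_nonneg.2 h1) (by positivity)), ← mul_div_assoc,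
    div_le_iff₀ (by positivity)]
  calc |newDir m i| * (4 ^ (i + 1) - 3 ^ (i + 1)) ≤ |newDir m i| * 6 ^ (i + 1) := by
        gcongr
        linarith [pow_pos (three_pos (α := ℝ)) (i + 1)]
    _ = (|newDir m i| * 2 ^ (i + 1)) * (3 * 3 ^ i) := by rw [h3]; ring
    _ ≤ 2 ^ m * (3 * 3 ^ i) := by gcongr
    _ = 3 * 2 ^ m * 3 ^ i := by ring

lemma softO_planeCoeff_one_zero_newDir :
    SoftO 2 (fun m => planeCoeff (newDir m) (2 * m) 1 0) := by
  refine ((softO_two_mul.mul (softO_pow (r := 2) (by norm_num))).mono (by norm_num)).of_abs_le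
    (Eventually.of_forall fun m => ?_)
  rw [planeCoeff_one_zero, abs_of_nonneg (by positivity : (0:ℝ) ≤ ((2 * m : ℕ) : ℝ) * 2 ^ m)]
  exact abs_dirOne_newDir_le m (2 * m)

lemma tendsto_planeCoeff_one_one_newDir :
    Tendsto (fun m => planeCoeff (newDir m) (2 * m) 1 1 / 8 ^ m) atTop (𝓝 (-1)) := by
  have h1 := ((softO_two_mul.add (softO_const 1)).mul
    softO_planeCoeff_one_zero_newDir).tendsto_div (s := 8) (by norm_num)
  have h := tendsto_dirTwo_newDir.sub h1
  rw [sub_zero] at h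
  refine h.congr fun m => ?_
  rw [planeCoeff_one_one, planeCoeff_one_zero]
  ring

lemma tendsto_planeCoeff_one_two_newDir :
    Tendsto (fun m => planeCoeff (newDir m) (2 * m) 1 2 / 18 ^ m) atTop (𝓝 (-(3 / 4))) := by
  have hN := softO_two_mul
  have h1 := ((hN.add (softO_const 1)).mul
    (SoftO.of_tendsto (by norm_num) tendsto_dirTwo_newDir)).tendsto_div (s := 18) (by norm_num)
  have h2 := (((hN.mul (hN.add (softO_const 1))).const_mul (1 / 2)).mul
    softO_planeCoeff_one_zero_newDir).tendsto_div (s := 18) (by norm_num)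
  have h := (tendsto_dirThree_newDir.sub h1).add h2
  rw [sub_zero, add_zero] at h
  refine h.congr fun m => ?_
  rw [planeCoeff_one_two, planeCoeff_one_zero]
  ring

lemma abs_planeCoeff_one_one_newDir_le {m n : ℕ} (hn : n ≤ 2 * m) :
    |planeCoeff (newDir m) n 1 1| ≤ 3 * (2 * m + 1) ^ 2 * (2 ^ n * 2 ^ m) := by
  have h1 := abs_dirOne_newDir_le m n
  have h2 := abs_dirTwo_newDir_le m n
  have hn' : (n : ℝ) ≤ 2 * m := by exact_mod_cast hn
  have h3 : (1 : ℝ) ≤ 2 ^ n := one_le_pow₀ (by norm_num)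
  rw [planeCoeff_one_one]
  refine (abs_sub _ _).trans ?_
  rw [abs_mul, abs_of_nonneg (by positivity : (0 : ℝ) ≤ (n : ℝ) + 1)]
  set M : ℝ := 2 * m + 1 with hM
  have hM1 : 1 ≤ M := by rw [hM]; linarith [(Nat.cast_nonneg m : (0 : ℝ) ≤ m)]
  have a1 : (n : ℝ) * (2 * 2 ^ m) ≤ M ^ 2 * (2 * 2 ^ m) := by
    gcongr; nlinarith
  have a2 : ((n : ℝ) + 1) * |dirOne (newDir m) n| ≤ M * (M * 2 ^ m) := by
    refine mul_le_mul (by linarith) (h1.trans ?_) (abs_nonneg _) (by linarith)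
    gcongr; linarith
  have a3 : M * (M * 2 ^ m) ≤ 2 ^ n * (M * (M * 2 ^ m)) :=
    le_mul_of_one_le_left (by positivity) h3
  have a4 : (2 : ℝ) ^ n * (n * (2 * 2 ^ m)) ≤ 2 ^ n * (M ^ 2 * (2 * 2 ^ m)) := by gcongr
  linarith

lemma abs_planeCoeff_one_two_newDir_le {m n : ℕ} (hn : n ≤ 2 * m) :
    |planeCoeff (newDir m) n 1 2| ≤ 6 * (2 * m + 1) ^ 3 * (3 ^ n * 2 ^ m) := by
  have h1 := abs_dirOne_newDir_le m n
  have h2 := abs_dirTwo_newDir_le m n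
  have h3 := abs_dirThree_newDir_le m n
  have hn' : (n : ℝ) ≤ 2 * m := by exact_mod_cast hn
  have h4 : (1 : ℝ) ≤ 3 ^ n := one_le_pow₀ (by norm_num)
  have h5 : (2 : ℝ) ^ n ≤ 3 ^ n := by gcongr; norm_num
  rw [planeCoeff_one_two]
  refine (abs_add_le _ _).trans ((add_le_add_left (abs_sub _ _) _).trans ?_)
  rw [abs_mul, abs_mul, abs_of_nonneg (by positivity : (0 : ℝ) ≤ (n : ℝ) + 1),
    abs_of_nonneg (by positivity : (0 : ℝ) ≤ n * ((n : ℝ) + 1) / 2)]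
  set M : ℝ := 2 * m + 1 with hM
  have hM1 : 1 ≤ M := by rw [hM]; linarith [(Nat.cast_nonneg m : (0 : ℝ) ≤ m)]
  have hnM : (n : ℝ) ≤ M := by linarith
  have hMM : M ≤ M ^ 3 := by nlinarith [sq_nonneg M]
  have hMM2 : M ^ 2 ≤ M ^ 3 := by nlinarith [sq_nonneg M]
  have a1 : (3 : ℝ) ^ n * (n * (3 * 2 ^ m)) ≤ 3 ^ n * (M ^ 3 * (3 * 2 ^ m)) := by
    gcongr; linarith
  have a2 : ((n : ℝ) + 1) * |dirTwo (newDir m) n| ≤ 3 ^ n * (M ^ 3 * (2 * 2 ^ m)) := by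
    calc ((n : ℝ) + 1) * |dirTwo (newDir m) n| ≤ M * (3 ^ n * (M * (2 * 2 ^ m))) := by
          refine mul_le_mul (by linarith) (h2.trans ?_) (abs_nonneg _) (by linarith)
          gcongr
      _ = 3 ^ n * (M ^ 2 * (2 * 2 ^ m)) := by ring
      _ ≤ _ := by gcongr
  have a3 : (n : ℝ) * ((n : ℝ) + 1) / 2 * |dirOne (newDir m) n| ≤ 3 ^ n * (M ^ 3 * 2 ^ m) := by
    calc (n : ℝ) * ((n : ℝ) + 1) / 2 * |dirOne (newDir m) n| ≤ M ^ 2 * (M * 2 ^ m) := by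
          refine mul_le_mul ?_ (h1.trans ?_) (abs_nonneg _) (by positivity)
          · have := (Nat.cast_nonneg n : (0 : ℝ) ≤ n)
            nlinarith
          · gcongr
      _ = 1 * (M ^ 3 * 2 ^ m) := by ring
      _ ≤ _ := by gcongr
  linarith

/-- Each increment is `δₙ` times a quantity of size `2^n 2^m`; the envelope `2^m/2^(n+1)` cancels
`2^n`, so every step costs `4^m` up to a polynomial. -/
lemma abs_planeCoeff_two_zero_newDir_le {m n : ℕ} (hn : n ≤ 2 * m) :
    |planeCoeff (newDir m) n 2 0| ≤ n * (4 * (2 * m + 1) ^ 2 * 4 ^ m) := by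
  induction n with
  | zero => simp [planeCoeff_zero_eq]
  | succ n ih =>
    have h1 := abs_dirOne_newDir_le m n
    rw [← planeCoeff_one_zero] at h1
    have h2 := abs_planeCoeff_one_one_newDir_le (m := m) (n := n) (by omega)
    have h3 := ih (by omega)
    have hn' : (n : ℝ) + 1 ≤ 2 * m := by exact_mod_cast hn
    have h4 : (1 : ℝ) ≤ 2 ^ n := one_le_pow₀ (by norm_num)
    rw [planeCoeff_two_zero_succ]
    refine (abs_add_le _ _).trans ?_
    rw [abs_mul]
    set M : ℝ := 2 * m + 1 with hM
    have hM1 : 1 ≤ M := by rw [hM]; linarith [(Nat.cast_nonneg m : (0 : ℝ) ≤ m)]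
    have a1 : |(n : ℝ) * planeCoeff (newDir m) n 1 0 + planeCoeff (newDir m) n 1 1| ≤
        4 * M ^ 2 * (2 ^ n * 2 ^ m) := by
      refine (abs_add_le _ _).trans ?_
      rw [abs_mul, abs_of_nonneg (Nat.cast_nonneg n : (0 : ℝ) ≤ n)]
      have : (n : ℝ) * |planeCoeff (newDir m) n 1 0| ≤ M ^ 2 * (2 ^ n * 2 ^ m) := by
        calc (n : ℝ) * |planeCoeff (newDir m) n 1 0| ≤ M * (M * 2 ^ m) := by
              refine mul_le_mul (by linarith) (h1.trans ?_) (abs_nonneg _) (by linarith)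
              gcongr; linarith
          _ = M ^ 2 * (1 * 2 ^ m) := by ring
          _ ≤ _ := by gcongr
      linarith
    have a2 : |newDir m n| * |(n : ℝ) * planeCoeff (newDir m) n 1 0 + planeCoeff (newDir m) n 1 1| ≤
        4 * M ^ 2 * 4 ^ m := by
      calc _ ≤ 2 ^ m / 2 ^ (n + 1) * (4 * M ^ 2 * (2 ^ n * 2 ^ m)) :=
            mul_le_mul (abs_newDir_le m n) a1 (abs_nonneg _) (by positivity)
        _ = 2 * M ^ 2 * 4 ^ m := by
            rw [show (4 : ℝ) ^ m = 2 ^ m * 2 ^ m by rw [← mul_pow]; norm_num]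
            field_simp; ring
        _ ≤ _ := by gcongr; norm_num
    push_cast
    linarith

/-- Same cancellation, now in a recursion with multiplier 2. At `n = 2m` the result is `16^m` up to
a polynomial, below the critical `18^m`. -/
lemma abs_planeCoeff_two_one_newDir_le {m n : ℕ} (hn : n ≤ 2 * m) :
    |planeCoeff (newDir m) n 2 1| ≤ n * (19 * (2 * m + 1) ^ 4 * 4 ^ m) * 2 ^ n := by
  induction n with
  | zero => simp [planeCoeff_zero_eq]
  | succ n ih =>
    have h1 := abs_planeCoeff_one_one_newDir_le (m := m) (n := n) (by omega)
    have h2 := abs_planeCoeff_one_two_newDir_le (m := m) (n := n) (by omega)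
    have h3 := abs_planeCoeff_two_zero_newDir_le (m := m) (n := n) (by omega)
    have h4 := ih (by omega)
    have hn' : (n : ℝ) + 1 ≤ 2 * m := by exact_mod_cast hn
    have hn0 : (0 : ℝ) ≤ n := Nat.cast_nonneg n
    have h5 : (1 : ℝ) ≤ 2 ^ n := one_le_pow₀ (by norm_num)
    have h6 : (2 : ℝ) ^ n ≤ 3 ^ n := by gcongr; norm_num
    have h7 : (3 : ℝ) ^ n ≤ 4 ^ n := by gcongr; norm_num
    have h8 : (4 : ℝ) ^ m = 2 ^ m * 2 ^ m := by rw [← mul_pow]; norm_num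
    have h9 : (4 : ℝ) ^ n = 2 ^ n * 2 ^ n := by rw [← mul_pow]; norm_num
    rw [planeCoeff_two_one_succ]
    refine (abs_add_le _ _).trans ((add_le_add_left (abs_add_le _ _) _).trans ?_)
    rw [abs_mul, abs_mul, abs_mul, abs_two]
    set M : ℝ := 2 * m + 1 with hM
    have hM1 : 1 ≤ M := by linarith
    have hn1 : |(n : ℝ) - 1| ≤ M := by rw [abs_le]; constructor <;> linarith
    have hMM : M ^ 3 ≤ M ^ 4 := by gcongr; norm_num
    have a1 : |(n : ℝ) - 1| * |planeCoeff (newDir m) n 2 0| ≤ 4 * M ^ 4 * 4 ^ m * 2 ^ n := by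
      calc _ ≤ M * (M * (4 * M ^ 2 * 4 ^ m)) := by
            refine mul_le_mul hn1 (h3.trans ?_) (abs_nonneg _) (by linarith)
            gcongr; linarith
        _ = 4 * M ^ 4 * 4 ^ m * 1 := by ring
        _ ≤ _ := by gcongr
    have a2 : |((n : ℝ) - 1) * planeCoeff (newDir m) n 1 1 + 2 * planeCoeff (newDir m) n 1 2| ≤
        15 * M ^ 4 * (4 ^ n * 2 ^ m) := by
      refine (abs_add_le _ _).trans ?_
      rw [abs_mul, abs_mul, abs_two]
      have b1 : |(n : ℝ) - 1| * |planeCoeff (newDir m) n 1 1| ≤ 3 * M ^ 4 * (4 ^ n * 2 ^ m) := by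
        calc _ ≤ M * (3 * M ^ 2 * (2 ^ n * 2 ^ m)) :=
              mul_le_mul hn1 h1 (abs_nonneg _) (by linarith)
          _ = 3 * M ^ 3 * (2 ^ n * 2 ^ m) := by ring
          _ ≤ _ := by gcongr; linarith
      -- Weakening `3^n` to `4^n` makes the increment after division by `2^n` of size `2^n`, the
      -- rate of the recursion itself.
      have b2 : 6 * M ^ 3 * (3 ^ n * 2 ^ m) ≤ 6 * M ^ 4 * (4 ^ n * 2 ^ m) := by gcongr
      linarith
    have a3 : |newDir m n| *
        |((n : ℝ) - 1) * planeCoeff (newDir m) n 1 1 + 2 * planeCoeff (newDir m) n 1 2| ≤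
        15 * M ^ 4 * 4 ^ m * 2 ^ n := by
      calc _ ≤ 2 ^ m / 2 ^ (n + 1) * (15 * M ^ 4 * (4 ^ n * 2 ^ m)) :=
            mul_le_mul (abs_newDir_le m n) a2 (abs_nonneg _) (by positivity)
        _ = 15 / 2 * M ^ 4 * 4 ^ m * 2 ^ n := by
            rw [h8, h9]
            field_simp; ring
        _ ≤ _ := by gcongr; norm_num
    push_cast
    rw [pow_succ (2 : ℝ) n]
    have a4 : 0 ≤ M ^ 4 * 4 ^ m * (2 : ℝ) ^ n := by positivity
    linarith

lemma softO_planeCoeff_two_zero_newDir :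
    SoftO 4 (fun m => planeCoeff (newDir m) (2 * m) 2 0) := by
  have hN := softO_two_mul
  have hM := hN.add (softO_const 1)
  have h := (hN.mul ((hM.mul hM).mul (softO_pow (r := 4) (by norm_num)))).const_mul 4
  refine (h.mono (by norm_num)).of_abs_le (Eventually.of_forall fun m => ?_)
  refine (abs_planeCoeff_two_zero_newDir_le le_rfl).trans (le_of_eq_of_le ?_ (le_abs_self _))
  push_cast; ring

lemma softO_planeCoeff_two_one_newDir :
    SoftO 16 (fun m => planeCoeff (newDir m) (2 * m) 2 1) := by
  have hN := softO_two_mul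
  have hM := hN.add (softO_const 1)
  have h := (hN.mul (((hM.mul hM).mul (hM.mul hM)).mul
    (softO_pow (r := 16) (by norm_num)))).const_mul 19
  refine (h.mono (by norm_num)).of_abs_le (Eventually.of_forall fun m => ?_)
  refine (abs_planeCoeff_two_one_newDir_le le_rfl).trans (le_of_eq_of_le ?_ (le_abs_self _))
  rw [pow_mul, show (16 : ℝ) ^ m = 4 ^ m * 4 ^ m by rw [← mul_pow]; norm_num]
  norm_num
  ring

/-! ### The optimal first entry -/

/-- A direction of negligible size compared with the all-ones vector. -/
structure IsSlight (δ : ℕ → ℝ) : Prop where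
  one_zero : SoftO 1 (fun m => planeCoeff δ (2 * m) 1 0)
  one_one : SoftO 4 (fun m => planeCoeff δ (2 * m) 1 1)
  one_two : SoftO 9 (fun m => planeCoeff δ (2 * m) 1 2)
  two_zero : ∀ n, planeCoeff δ n 2 0 = 0
  two_one : ∀ n, planeCoeff δ n 2 1 = 0

lemma isSlight_zero : IsSlight 0 where
  one_zero := by simpa only [planeCoeff_one_zero_of_zero] using softO_const 0
  one_one := by
    simpa only [planeCoeff_one_one_of_zero] using (softO_const 0).mono (by norm_num)
  one_two := by
    simpa only [planeCoeff_one_two_of_zero] using (softO_const 0).mono (by norm_num)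
  two_zero := planeCoeff_two_zero_of_zero
  two_one := planeCoeff_two_one_of_zero

lemma sum_oldDir_mul {n : ℕ} (hn : n ≠ 0) (w : ℕ → ℝ) :
    ∑ i ∈ Finset.range n, oldDir i * w i = -2 * w 0 := by
  rw [Finset.sum_eq_single 0]
  · simp [oldDir]
  · intro i _ hi
    simp [oldDir, hi]
  · intro h
    simp at h
    exact absurd h hn

lemma dirOne_oldDir {n : ℕ} (hn : n ≠ 0) : dirOne oldDir n = -2 := by
  rw [dirOne, sum_oldDir_mul hn]; norm_num

lemma dirTwo_oldDir {n : ℕ} (hn : n ≠ 0) : dirTwo oldDir n = -2 * 2 ^ n := by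
  rw [dirTwo, sum_oldDir_mul hn]; norm_num; ring

lemma dirThree_oldDir {n : ℕ} (hn : n ≠ 0) : dirThree oldDir n = -2 * 3 ^ n := by
  rw [dirThree, sum_oldDir_mul hn]; norm_num; ring

lemma planeCoeff_two_zero_oldDir (n : ℕ) : planeCoeff oldDir n 2 0 = 0 := by
  induction n with
  | zero => simp [planeCoeff_zero_eq]
  | succ n ih =>
    rw [planeCoeff_two_zero_succ, ih]
    cases n <;> simp [planeCoeff_zero_eq, oldDir]

lemma planeCoeff_two_one_oldDir (n : ℕ) : planeCoeff oldDir n 2 1 = 0 := by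
  induction n with
  | zero => simp [planeCoeff_zero_eq]
  | succ n ih =>
    rw [planeCoeff_two_one_succ, ih, planeCoeff_two_zero_oldDir]
    cases n <;> simp [planeCoeff_zero_eq, oldDir]

lemma isSlight_oldDir : IsSlight oldDir where
  one_zero := by
    refine (softO_const (-2)).congr ?_
    filter_upwards [eventually_ge_atTop 1] with m hm
    rw [planeCoeff_one_zero, dirOne_oldDir (by omega)]
  one_one := by
    have h1 := (softO_pow (r := 4) (by norm_num)).const_mul (-2)
    have h2 := (softO_two_mul.add (softO_const 1)).const_mul 2
    refine (h1.add (h2.mono (by norm_num))).congr ?_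
    filter_upwards [eventually_ge_atTop 1] with m hm
    rw [planeCoeff_one_one, dirOne_oldDir (by omega), dirTwo_oldDir (by omega), pow_mul]
    norm_num; ring
  one_two := by
    have hN := softO_two_mul
    have h1 := (softO_pow (r := 9) (by norm_num)).const_mul (-2)
    have h2 := ((hN.add (softO_const 1)).mul (softO_pow (r := 4) (by norm_num))).const_mul 2
    have h3 := hN.mul (hN.add (softO_const 1))
    refine ((h1.add (h2.mono (by norm_num))).sub (h3.mono (by norm_num))).congr ?_
    filter_upwards [eventually_ge_atTop 1] with m hm
    rw [planeCoeff_one_two, dirOne_oldDir (by omega), dirTwo_oldDir (by omega),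
      dirThree_oldDir (by omega), pow_mul, pow_mul]
    norm_num; ring
  two_zero := planeCoeff_two_zero_oldDir
  two_one := planeCoeff_two_one_oldDir

lemma tendsto_two_mul_atTop : Tendsto (fun m : ℕ => ((2 * m : ℕ) : ℝ)) atTop atTop :=
  tendsto_natCast_atTop_atTop.comp (tendsto_id.const_mul_atTop' two_pos)

lemma tendsto_two_mul_inv : Tendsto (fun m : ℕ => (((2 * m : ℕ) : ℝ))⁻¹) atTop (𝓝 0) :=
  tendsto_inv_atTop_zero.comp tendsto_two_mul_atTop

section Slight

variable {δ : ℕ → ℝ}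

lemma IsSlight.tendsto_lin (h : IsSlight δ) :
    Tendsto (fun m => (eulOne (2 * m) + planeCoeff δ (2 * m) 1 0) / 4 ^ m) atTop (𝓝 2) := by
  have := tendsto_eulOne.add (h.one_zero.tendsto_div (s := 4) (by norm_num))
  rw [add_zero] at this
  exact this.congr fun m => by ring

lemma IsSlight.softO_lin (h : IsSlight δ) :
    SoftO 4 (fun m => eulOne (2 * m) + planeCoeff δ (2 * m) 1 0) :=
  .of_tendsto (by norm_num) h.tendsto_lin

lemma IsSlight.tendsto_optA (h : IsSlight δ) :
    Tendsto (fun m => optA δ (2 * m) / (((2 * m : ℕ) : ℝ) * 16 ^ m)) atTop (𝓝 4) := by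
  have h1 := tendsto_eulOne.mul h.tendsto_lin
  have h2 := ((softO_eulTwo.const_mul 2).add (h.one_one.mono (by norm_num))).tendsto_div
    (s := 16) (by norm_num)
  have h3 := (h1.sub h2).sub (h1.mul tendsto_two_mul_inv)
  norm_num only at h3
  refine h3.congr' ?_
  filter_upwards [eventually_ge_atTop 1] with m hm
  have hm' : ((2 * m : ℕ) : ℝ) ≠ 0 := by exact_mod_cast (by omega : 2 * m ≠ 0)
  rw [optA, show (16 : ℝ) ^ m = 4 ^ m * 4 ^ m by rw [← mul_pow]; norm_num]
  field_simp

lemma IsSlight.formD_eq (h : IsSlight δ) (n : ℕ) :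
    formD δ n 0 = (eulOne n + planeCoeff δ n 1 0) ^ 2 - 2 * (eulTwo n + planeCoeff δ n 1 1) := by
  rw [formD, h.two_zero]; ring

lemma IsSlight.formN_eq (h : IsSlight δ) (n : ℕ) :
    formN δ n 0 = eulOne n * (eulOne n + planeCoeff δ n 1 0) ^ 2 +
      (-(eulOne n * (eulTwo n + planeCoeff δ n 1 1)) -
      (eulOne n + planeCoeff δ n 1 0) * (2 * eulTwo n + planeCoeff δ n 1 1) +
      (3 * eulThree n + 2 * planeCoeff δ n 1 2)) := by
  rw [formN, h.two_zero, h.two_one]; ring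

/-- The leading products `e₁(e₁ + f₁₀)³` cancel, which brings the order down from `256^m` to that of
`e₁²e₂`, namely `144^m`. -/
lemma IsSlight.optC_eq (h : IsSlight δ) (n : ℕ) :
    optC δ n = eulOne n * (eulOne n + planeCoeff δ n 1 0) * (eulTwo n + planeCoeff δ n 1 1) +
      ((eulOne n + planeCoeff δ n 1 0) * (3 * eulThree n + 2 * planeCoeff δ n 1 2) -
      2 * ((2 * eulTwo n + planeCoeff δ n 1 1) * (eulTwo n + planeCoeff δ n 1 1))) := by
  rw [optC, h.formN_eq, h.formD_eq]; ring

lemma IsSlight.softO_two_add (h : IsSlight δ) :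
    SoftO 9 (fun m => eulTwo (2 * m) + planeCoeff δ (2 * m) 1 1) :=
  softO_eulTwo.add (h.one_one.mono (by norm_num))

lemma IsSlight.softO_two_mul_two_add (h : IsSlight δ) :
    SoftO 9 (fun m => 2 * eulTwo (2 * m) + planeCoeff δ (2 * m) 1 1) :=
  (softO_eulTwo.const_mul 2).add (h.one_one.mono (by norm_num))

lemma IsSlight.softO_three_add (h : IsSlight δ) :
    SoftO 16 (fun m => 3 * eulThree (2 * m) + 2 * planeCoeff δ (2 * m) 1 2) :=
  (softO_eulThree.const_mul 3).add ((h.one_two.mono (by norm_num)).const_mul 2)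

lemma IsSlight.tendsto_formD (h : IsSlight δ) :
    Tendsto (fun m => formD δ (2 * m) 0 / 16 ^ m) atTop (𝓝 4) := by
  have h1 := h.tendsto_lin.pow 2
  have h2 := (h.softO_two_add.const_mul 2).tendsto_div (s := 16) (by norm_num)
  have h3 := h1.sub h2
  norm_num only at h3
  refine h3.congr fun m => ?_
  rw [h.formD_eq, show (16 : ℝ) ^ m = 4 ^ m * 4 ^ m by rw [← mul_pow]; norm_num]
  field_simp

lemma IsSlight.tendsto_formN (h : IsSlight δ) :
    Tendsto (fun m => formN δ (2 * m) 0 / 64 ^ m) atTop (𝓝 8) := by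
  have h1 := tendsto_eulOne.mul (h.tendsto_lin.pow 2)
  have h2 := (((softO_eulOne.mul h.softO_two_add).mono (s := 36) (by norm_num)).neg.sub
    ((h.softO_lin.mul h.softO_two_mul_two_add).mono (by norm_num))).add
    (h.softO_three_add.mono (by norm_num))
  have h3 := h1.add (h2.tendsto_div (s := 64) (by norm_num))
  norm_num only at h3
  refine h3.congr fun m => ?_
  rw [h.formN_eq, show (64 : ℝ) ^ m = 4 ^ m * (4 ^ m * 4 ^ m) by
    rw [← mul_pow, ← mul_pow]; norm_num]
  field_simp

lemma IsSlight.tendsto_optB (h : IsSlight δ) :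
    Tendsto (fun m => optB δ (2 * m) / (((2 * m : ℕ) : ℝ) * 64 ^ m)) atTop (𝓝 8) := by
  have h3 := h.tendsto_formN.sub ((tendsto_eulOne.mul h.tendsto_formD).mul tendsto_two_mul_inv)
  norm_num only at h3
  refine h3.congr' ?_
  filter_upwards [eventually_ge_atTop 1] with m hm
  have hm' : ((2 * m : ℕ) : ℝ) ≠ 0 := by exact_mod_cast (by omega : 2 * m ≠ 0)
  rw [optB, show (64 : ℝ) ^ m = 4 ^ m * 16 ^ m by rw [← mul_pow]; norm_num]
  field_simp

lemma IsSlight.tendsto_optC (h : IsSlight δ) :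
    Tendsto (fun m => optC δ (2 * m) / 144 ^ m) atTop (𝓝 12) := by
  have h0 := tendsto_eulTwo.add (h.one_one.tendsto_div (s := 9) (by norm_num))
  have h1 := (tendsto_eulOne.mul h.tendsto_lin).mul h0
  have h2 := ((h.softO_lin.mul h.softO_three_add).mono (s := 81) (by norm_num)).sub
    (((h.softO_two_mul_two_add.mul h.softO_two_add).mono (s := 81) (by norm_num)).const_mul 2)
  have h3 := h1.add (h2.tendsto_div (s := 144) (by norm_num))
  norm_num only at h3
  refine h3.congr fun m => ?_
  rw [h.optC_eq, show (144 : ℝ) ^ m = 4 ^ m * (4 ^ m * 9 ^ m) by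
    rw [← mul_pow, ← mul_pow]; norm_num]
  field_simp

/-- Size bounds for the coefficients of the optimality condition. -/
structure OptBounds (N : ℝ) (m : ℕ) (a b c : ℝ) : Prop where
  a_pos : 0 < a
  c_pos : 0 < c
  a_le : a ≤ 5 * (N * 16 ^ m)
  le_b : 7 * (N * 64 ^ m) ≤ b
  c_le : c ≤ 13 * 144 ^ m

lemma IsSlight.optBounds (h : IsSlight δ) :
    ∀ᶠ m : ℕ in atTop, OptBounds ((2 * m : ℕ) : ℝ) m
      (optA δ (2 * m)) (optB δ (2 * m)) (optC δ (2 * m)) := by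
  filter_upwards [h.tendsto_optA.eventually_lt_const (show (4 : ℝ) < 5 by norm_num),
    h.tendsto_optA.eventually_const_lt (show (0 : ℝ) < 4 by norm_num),
    h.tendsto_optB.eventually_const_lt (show (7 : ℝ) < 8 by norm_num),
    h.tendsto_optC.eventually_const_lt (show (0 : ℝ) < 12 by norm_num),
    h.tendsto_optC.eventually_lt_const (show (12 : ℝ) < 13 by norm_num),
    eventually_ge_atTop 1] with m h1 h2 h3 h4 h5 hm
  have hN : (0 : ℝ) < ((2 * m : ℕ) : ℝ) := by exact_mod_cast (by omega : 0 < 2 * m)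
  rw [div_lt_iff₀ (by positivity)] at h1 h5
  rw [lt_div_iff₀ (by positivity)] at h2 h3 h4
  exact ⟨by linarith, by linarith, h1.le, h3.le, h5.le⟩

end Slight

/-- With `s` the root of the discriminant, `(b - s)(b + s) = 4ac`, so the modulus is `2c/(b + s) ≤
2c/b`. -/
lemma smallRoot_spec {a b c : ℝ} (ha : 0 < a) (hb : 0 < b) (hc : 0 < c) (h : 4 * a * c ≤ b ^ 2) :
    a * smallRoot a b c ^ 2 + b * smallRoot a b c + c = 0 ∧
      |smallRoot a b c| ≤ 2 * c / b := by
  set s := √(b ^ 2 - 4 * a * c) with hs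
  have hs0 : 0 ≤ s := Real.sqrt_nonneg _
  have hss : s ^ 2 = b ^ 2 - 4 * a * c := Real.sq_sqrt (by linarith)
  have hac : 0 < a * c := mul_pos ha hc
  have hsb : s ≤ b := by
    apply le_of_sq_le_sq _ hb.le
    linarith
  have hy : smallRoot a b c = (-b + s) / (2 * a) := rfl
  constructor
  · rw [hy]
    field_simp
    linear_combination hss
  · rw [hy, abs_of_nonpos (div_nonpos_of_nonpos_of_nonneg (by linarith) (by linarith)),
      ← neg_div, div_le_div_iff₀ (by positivity) hb]
    nlinarith

lemma OptBounds.smallRoot_spec {N : ℝ} {m : ℕ} {a b c : ℝ} (h : OptBounds N m a b c)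
    (hN : 6 ≤ N) :
    4 * a * c ≤ b ^ 2 ∧ a * smallRoot a b c ^ 2 + b * smallRoot a b c + c = 0 ∧
      N * |smallRoot a b c| ≤ 4 * (9 / 4) ^ m := by
  have hb : 0 < b := lt_of_lt_of_le (by positivity) h.le_b
  have h1 : 4 * a * c ≤ b ^ 2 := by
    calc 4 * a * c ≤ 4 * (5 * (N * 16 ^ m)) * (13 * 144 ^ m) := by
          have := h.a_pos
          have := h.c_pos
          gcongr
          · exact h.a_le
          · exact h.c_le
      _ = N * 260 * 2304 ^ m := by
          rw [show (2304 : ℝ) ^ m = 16 ^ m * 144 ^ m by rw [← mul_pow]; norm_num]; ring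
      -- This is where `6 ≤ N` is used: `260 ≤ 49N`.
      _ ≤ N * (49 * N) * 4096 ^ m := by
          gcongr
          · linarith
          · norm_num
      _ = (7 * (N * 64 ^ m)) ^ 2 := by
          rw [show (4096 : ℝ) ^ m = 64 ^ m * 64 ^ m by rw [← mul_pow]; norm_num]; ring
      _ ≤ b ^ 2 := by
          gcongr
          exact h.le_b
  obtain ⟨h2, h3⟩ := EulerianRelaxation.smallRoot_spec h.a_pos hb h.c_pos h1
  refine ⟨h1, h2, ?_⟩
  calc N * |smallRoot a b c| ≤ N * (2 * c / b) := by gcongr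
    _ ≤ N * (2 * (13 * 144 ^ m) / (7 * (N * 64 ^ m))) := by
        have := h.c_pos
        gcongr
        · exact h.c_le
        · exact h.le_b
    _ = 26 / 7 * (9 / 4) ^ m := by
        rw [show (144 : ℝ) = 9 / 4 * 64 by norm_num, mul_pow]
        field_simp
        norm_num
    _ ≤ _ := by gcongr; norm_num

/-- The optimal first entry for the direction `1 + δ`, where `n = 2 m`. -/
def optY (δ : ℕ → ℝ) (m : ℕ) : ℝ :=
  smallRoot (optA δ (2 * m)) (optB δ (2 * m)) (optC δ (2 * m))

lemma eventually_six_le : ∀ᶠ m : ℕ in atTop, (6 : ℝ) ≤ ((2 * m : ℕ) : ℝ) :=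
  tendsto_two_mul_atTop.eventually_ge_atTop 6

/-- Since `b` carries a factor `n` and `c` does not, the root is `O((9/4)^m / n)`. -/
lemma IsSlight.tendsto_optY {δ : ℕ → ℝ} (h : IsSlight δ) :
    Tendsto (fun m => optY δ m / (9 / 4) ^ m) atTop (𝓝 0) := by
  have h1 := tendsto_two_mul_inv.const_mul 4
  rw [mul_zero] at h1
  refine squeeze_zero_norm' ?_ h1
  filter_upwards [h.optBounds, eventually_six_le] with m hm hN
  have := (hm.smallRoot_spec hN).2.2
  rw [Real.norm_eq_abs, abs_div, abs_of_pos (by positivity : (0 : ℝ) < (9 / 4) ^ m),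
    div_le_iff₀ (by positivity), mul_right_comm, ← div_eq_mul_inv, le_div_iff₀ (by linarith),
    mul_comm]
  exact this

lemma IsSlight.softO_optY {δ : ℕ → ℝ} (h : IsSlight δ) : SoftO (9 / 4) (optY δ) :=
  .of_tendsto (by norm_num) h.tendsto_optY

lemma IsSlight.softO_optA_sub {δ : ℕ → ℝ} (h : IsSlight δ) :
    SoftO 4 (fun m => optA δ (2 * m) - optA 0 (2 * m)) := by
  have h1 := (softO_eulOne.mul h.one_zero).mono (s := 4) (by norm_num)
  have h2 := ((softO_two_mul.mul (h1.sub h.one_one)).mono (s := 4) (by norm_num)).sub h1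
  refine h2.congr (Eventually.of_forall fun m => ?_)
  rw [optA, optA, planeCoeff_one_zero_of_zero, planeCoeff_one_one_of_zero]
  ring

lemma IsSlight.softO_optB_sub {δ : ℕ → ℝ} (h : IsSlight δ) :
    SoftO 16 (fun m => optB δ (2 * m) - optB 0 (2 * m)) := by
  have e1 := softO_eulOne
  have e2 := softO_eulTwo
  have f0 := h.one_zero
  have f1 := h.one_one
  have hD := ((((e1.mul f0).mono (s := 4) (by norm_num)).const_mul 2).add
    ((f0.mul f0).mono (by norm_num))).sub (f1.const_mul 2)
  have hN := ((((((e1.mul (e1.mul f0)).mono (s := 16) (by norm_num)).const_mul 2).add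
    ((e1.mul (f0.mul f0)).mono (by norm_num))).sub
    (((e1.mul f1).mono (s := 16) (by norm_num)).const_mul 2)).sub
    (((f0.mul e2).mono (s := 16) (by norm_num)).const_mul 2)).sub
    ((f0.mul f1).mono (by norm_num)) |>.add ((h.one_two.mono (by norm_num)).const_mul 2)
  refine (((softO_two_mul.mul hN).mono (s := 16) (by norm_num)).sub
    ((e1.mul hD).mono (by norm_num))).congr (Eventually.of_forall fun m => ?_)
  rw [optB, optB, h.formN_eq, h.formD_eq, isSlight_zero.formN_eq, isSlight_zero.formD_eq,
    planeCoeff_one_zero_of_zero, planeCoeff_one_one_of_zero, planeCoeff_one_two_of_zero]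
  ring

lemma IsSlight.softO_optC_sub {δ : ℕ → ℝ} (h : IsSlight δ) :
    SoftO 64 (fun m => optC δ (2 * m) - optC 0 (2 * m)) := by
  have e1 := softO_eulOne
  have e2 := softO_eulTwo
  have f0 := h.one_zero
  have f1 := h.one_one
  have h1 := (e1.mul (e1.mul f1)).mono (s := 64) (by norm_num)
  have h2 := (e1.mul (f0.mul h.softO_two_add)).mono (s := 64) (by norm_num)
  have h3 := ((f0.mul softO_eulThree).mono (s := 64) (by norm_num)).const_mul 3
  have h4 := ((h.softO_lin.mul h.one_two).mono (s := 64) (by norm_num)).const_mul 2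
  have h5 := ((e2.mul f1).mono (s := 64) (by norm_num)).const_mul (-6)
  have h6 := ((f1.mul f1).mono (s := 64) (by norm_num)).const_mul (-2)
  refine (((((h1.add h2).add h3).add h4).add h5).add h6).congr (Eventually.of_forall fun m => ?_)
  rw [h.optC_eq, isSlight_zero.optC_eq,
    planeCoeff_one_zero_of_zero, planeCoeff_one_one_of_zero, planeCoeff_one_two_of_zero]
  ring

/-- Subtracting the two quadratic equations isolates the difference of the roots times a factor of
size at least `64^m`; the perturbation of the coefficients is `64^m` up to a polynomial. -/
lemma IsSlight.softO_optY_sub {δ : ℕ → ℝ} (h : IsSlight δ) :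
    SoftO 1 (fun m => optY δ m - optY 0 m) := by
  have hy := h.softO_optY
  have hnum := ((((h.softO_optA_sub.mul (hy.mul hy)).mono (s := 64) (by norm_num)).add
    ((h.softO_optB_sub.mul hy).mono (by norm_num))).add h.softO_optC_sub)
  have hq := (hnum.mul (softO_pow (r := 1 / 64) (by norm_num))).mono (s := 1) (by norm_num)
  refine hq.of_abs_le ?_
  filter_upwards [h.optBounds, isSlight_zero.optBounds, eventually_six_le] with m hm hm0 hN
  obtain ⟨-, r, br⟩ := hm.smallRoot_spec hN
  obtain ⟨-, r0, br0⟩ := hm0.smallRoot_spec hN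
  change _ * optY δ m ^ 2 + _ * optY δ m + _ = 0 at r
  change _ * optY 0 m ^ 2 + _ * optY 0 m + _ = 0 at r0
  change _ * |optY δ m| ≤ _ at br
  change _ * |optY 0 m| ≤ _ at br0
  set y := optY δ m
  set z := optY 0 m
  set N : ℝ := ((2 * m : ℕ) : ℝ)
  -- The term `b` is at least `42·64^m` since `N ≥ 6`, while the term with `a` is at most `40·36^m`
  -- in modulus.
  have hE : 64 ^ m ≤ optA 0 (2 * m) * (y + z) + optB 0 (2 * m) := by
    have h1 : -(40 * (64 : ℝ) ^ m) ≤ optA 0 (2 * m) * (y + z) := by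
      have h2 : |optA 0 (2 * m) * (y + z)| ≤ 40 * 64 ^ m := by
        rw [abs_mul, abs_of_pos hm0.a_pos]
        calc optA 0 (2 * m) * |y + z| ≤ 5 * (N * 16 ^ m) * (|y| + |z|) := by
              gcongr
              · exact hm0.a_le
              · exact abs_add_le _ _
          _ = 5 * 16 ^ m * (N * |y| + N * |z|) := by ring
          _ ≤ 5 * 16 ^ m * (4 * (9 / 4) ^ m + 4 * (9 / 4) ^ m) := by gcongr
          _ = 40 * 36 ^ m := by
              rw [show (36 : ℝ) = 16 * (9 / 4) by norm_num, mul_pow]; ring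
          _ ≤ _ := by gcongr; norm_num
      exact (abs_le.1 h2).1
    have h3 : 42 * (64 : ℝ) ^ m ≤ 7 * (N * 64 ^ m) := by
      have : (0 : ℝ) < 64 ^ m := by positivity
      nlinarith
    have := hm0.le_b
    have : (0 : ℝ) < 64 ^ m := by positivity
    linarith
  have hid : (y - z) * (optA 0 (2 * m) * (y + z) + optB 0 (2 * m)) =
      -((optA δ (2 * m) - optA 0 (2 * m)) * (y * y) + (optB δ (2 * m) - optB 0 (2 * m)) * y +
        (optC δ (2 * m) - optC 0 (2 * m))) := by
    linear_combination r - r0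
  have h64 : (0 : ℝ) < 64 ^ m := by positivity
  rw [abs_mul, abs_of_pos (by positivity : (0 : ℝ) < (1 / 64) ^ m), one_div, inv_pow,
    ← div_eq_mul_inv, le_div_iff₀ h64, ← abs_neg (_ + _), ← hid, abs_mul]
  gcongr
  exact hE.trans (le_abs_self _)

/-! ### The two bounds -/

lemma yVal_two_mul (m : ℕ) : yVal (2 * m) = optY oldDir m := yVal_eq _

lemma tendsto_formD {δ : ℕ → ℕ → ℝ} {y : ℕ → ℝ} (hy : SoftO (9 / 4) y)
    (f0 : SoftO 2 (fun m => planeCoeff (δ m) (2 * m) 1 0))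
    (f1 : SoftO 8 (fun m => planeCoeff (δ m) (2 * m) 1 1))
    (g0 : SoftO 4 (fun m => planeCoeff (δ m) (2 * m) 2 0)) :
    Tendsto (fun m => formD (δ m) (2 * m) (y m) / 16 ^ m) atTop (𝓝 4) := by
  have h1 := tendsto_eulOne.add (f0.tendsto_div (s := 4) (by norm_num))
  rw [add_zero] at h1
  have hl : SoftO 4 (fun m => eulOne (2 * m) + planeCoeff (δ m) (2 * m) 1 0) :=
    softO_eulOne.add (f0.mono (by norm_num))
  have h2 := (((softO_two_mul.mul (hy.mul hy)).mono (s := 9) (by norm_num)).add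
    (((hy.mul hl).mono (s := 9) (by norm_num)).const_mul 2)).sub
    (((softO_eulTwo.add (f1.mono (by norm_num))).add (g0.mono (by norm_num))).const_mul 2)
  have h3 := (h1.pow 2).add (h2.tendsto_div (s := 16) (by norm_num))
  norm_num only at h3
  refine h3.congr fun m => ?_
  rw [formD, show (16 : ℝ) ^ m = 4 ^ m * 4 ^ m by rw [← mul_pow]; norm_num]
  field_simp
  ring

/-- Only `e₁(e₁ + f₁₀)²` reaches order `64^m`; all other terms are at most `36^m` up to a
polynomial. -/
lemma tendsto_formN {δ : ℕ → ℕ → ℝ} {y : ℕ → ℝ} (hy : SoftO (9 / 4) y)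
    (f0 : SoftO 2 (fun m => planeCoeff (δ m) (2 * m) 1 0))
    (f1 : SoftO 8 (fun m => planeCoeff (δ m) (2 * m) 1 1))
    (f2 : SoftO 18 (fun m => planeCoeff (δ m) (2 * m) 1 2))
    (g0 : SoftO 4 (fun m => planeCoeff (δ m) (2 * m) 2 0))
    (g1 : SoftO 16 (fun m => planeCoeff (δ m) (2 * m) 2 1)) :
    Tendsto (fun m => formN (δ m) (2 * m) (y m) / 64 ^ m) atTop (𝓝 8) := by
  have h1 := tendsto_eulOne.add (f0.tendsto_div (s := 4) (by norm_num))
  rw [add_zero] at h1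
  have e1 := softO_eulOne
  have e2 := softO_eulTwo
  have hl : SoftO 4 (fun m => eulOne (2 * m) + planeCoeff (δ m) (2 * m) 1 0) :=
    e1.add (f0.mono (by norm_num))
  have hR := (e2.const_mul 2).add (f1.mono (by norm_num))
  have hQ := (e2.add (f1.mono (by norm_num))).add (g0.mono (by norm_num))
  have t1 := (e1.mul (hy.mul hy)).mono (s := 36) (by norm_num)
  have t2 := ((hy.mul (((e1.mul hl).mono (s := 16) (by norm_num)).sub
    (hR.mono (by norm_num)))).mono (s := 36) (by norm_num)).const_mul 2
  have t3 := (e1.mul hQ).mono (s := 36) (by norm_num)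
  have t4 := (hl.mul hR).mono (s := 36) (by norm_num)
  have t5 := (softO_eulThree.mono (s := 36) (by norm_num)).const_mul 3
  have t6 := (f2.mono (s := 36) (by norm_num)).const_mul 2
  have t7 := g1.mono (s := 36) (by norm_num)
  have h2 := (((((t1.add t2).sub t3).sub t4).add t5).add t6).add t7
  have h3 := (tendsto_eulOne.mul (h1.pow 2)).add (h2.tendsto_div (s := 64) (by norm_num))
  norm_num only at h3
  refine h3.congr fun m => ?_
  rw [formN, show (64 : ℝ) ^ m = 4 ^ m * (4 ^ m * 4 ^ m) by
    rw [← mul_pow, ← mul_pow]; norm_num]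
  field_simp
  ring

lemma tendsto_newD : Tendsto (fun m => newD m / 16 ^ m) atTop (𝓝 4) := by
  simp only [newD_eq, yVal_two_mul]
  exact tendsto_formD isSlight_oldDir.softO_optY softO_planeCoeff_one_zero_newDir
    (.of_tendsto (by norm_num) tendsto_planeCoeff_one_one_newDir)
    softO_planeCoeff_two_zero_newDir

lemma tendsto_newN : Tendsto (fun m => newN m / 64 ^ m) atTop (𝓝 8) := by
  simp only [newN_eq, yVal_two_mul]
  exact tendsto_formN isSlight_oldDir.softO_optY softO_planeCoeff_one_zero_newDir
    (.of_tendsto (by norm_num) tendsto_planeCoeff_one_one_newDir)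
    (.of_tendsto (by norm_num) tendsto_planeCoeff_one_two_newDir)
    softO_planeCoeff_two_zero_newDir softO_planeCoeff_two_one_newDir

/-- The value of `vᵀ A₀ v` at the optimal vector `(y, 1, …, 1)`. -/
def unD (m : ℕ) : ℝ := formD 0 (2 * m) (optY 0 m)

/-- The value of `vᵀ (A₁ + ⋯ + Aₙ) v` at the optimal vector `(y, 1, …, 1)`. -/
def unN (m : ℕ) : ℝ := formN 0 (2 * m) (optY 0 m)

lemma tendsto_unD : Tendsto (fun m => unD m / 16 ^ m) atTop (𝓝 4) :=
  tendsto_formD (δ := fun _ => 0) isSlight_zero.softO_optY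
    (isSlight_zero.one_zero.mono (by norm_num)) (isSlight_zero.one_one.mono (by norm_num))
    (by simpa only [planeCoeff_two_zero_of_zero] using (softO_const 0).mono (by norm_num))

lemma tendsto_unN : Tendsto (fun m => unN m / 64 ^ m) atTop (𝓝 8) :=
  tendsto_formN (δ := fun _ => 0) isSlight_zero.softO_optY
    (isSlight_zero.one_zero.mono (by norm_num)) (isSlight_zero.one_one.mono (by norm_num))
    (isSlight_zero.one_two.mono (by norm_num))
    (by simpa only [planeCoeff_two_zero_of_zero] using (softO_const 0).mono (by norm_num))
    (by simpa only [planeCoeff_two_one_of_zero] using (softO_const 0).mono (by norm_num))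

lemma eventually_pos_of_tendsto_div {f : ℕ → ℝ} {r c : ℝ} (hr : 0 < r) (hc : 0 < c)
    (h : Tendsto (fun m => f m / r ^ m) atTop (𝓝 c)) : ∀ᶠ m in atTop, 0 < f m := by
  filter_upwards [h.eventually_const_lt hc] with m hm
  rwa [lt_div_iff₀ (by positivity), zero_mul] at hm

lemma unBound_two_mul : ∀ᶠ m : ℕ in atTop, unBound (2 * m) = unN m / unD m := by
  have hq := tendsto_unN.div tendsto_unD (by norm_num)
  norm_num only at hq
  filter_upwards [isSlight_zero.optBounds, eventually_six_le,
    eventually_pos_of_tendsto_div (by norm_num) (by norm_num) tendsto_unD,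
    eventually_pos_of_tendsto_div (by norm_num) (by norm_num) tendsto_unN,
    hq.eventually_const_lt (show (1 : ℝ) < 2 by norm_num),
    tendsto_eulOne.eventually_lt_const (show (2 : ℝ) < 3 by norm_num)] with m hm hN hD hN' hq' he
  refine unBound_eq _ _ (hm.smallRoot_spec hN).2.1 hD hN' ?_
  change _ ≤ _ * (unN m / unD m)
  rw [div_lt_iff₀ (by positivity)] at he
  -- The quotient is about `2·4^m`; with `e₁ < 3·4^m` and `n ≥ 6` this yields the condition `e₁ ≤ n
  -- N/D`.
  have h1 : (4 : ℝ) ^ m ≤ unN m / unD m := by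
    have : unN m / 64 ^ m / (unD m / 16 ^ m) = unN m / unD m / 4 ^ m := by
      rw [show (64 : ℝ) ^ m = 4 ^ m * 16 ^ m by rw [← mul_pow]; norm_num]
      field_simp
    simp only [Pi.div_apply] at hq'
    rw [this, lt_div_iff₀ (by positivity), one_mul] at hq'
    exact hq'.le
  have h4 : (0 : ℝ) < 4 ^ m := by positivity
  nlinarith

/-! ### The difference of the bounds -/

/-- The excess `N - e₁ D` at the optimal vector `(y, 1, …, 1)`. -/
def unExcess (m : ℕ) : ℝ := unN m - eulOne (2 * m) * unD m

lemma unExcess_eq (m : ℕ) :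
    unExcess m = -((((2 * m : ℕ) : ℝ) - 1) * (eulOne (2 * m) * (optY 0 m * optY 0 m))) -
      4 * (optY 0 m * eulTwo (2 * m)) - eulOne (2 * m) * eulTwo (2 * m) +
      3 * eulThree (2 * m) := by
  rw [unExcess, unN, unD, formN_zero, formD_zero]; ring

/-- The dominant term of the excess is `-e₁e₂ ~ -6·36^m`, over `D₁ ~ 4·16^m`. -/
lemma tendsto_unExcess_div :
    Tendsto (fun m => unExcess m / unD m / (9 / 4) ^ m) atTop (𝓝 (-(3 / 2))) := by
  have hz := isSlight_zero.softO_optY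
  have t1 := ((softO_two_mul.sub (softO_const 1)).mul (softO_eulOne.mul (hz.mul hz))).mono
    (s := 81 / 4) (by norm_num)
  have t2 := ((hz.mul softO_eulTwo).mono (s := 81 / 4) (by norm_num)).const_mul 4
  have t3 := (softO_eulThree.mono (s := 81 / 4) (by norm_num)).const_mul 3
  have h1 := ((t1.neg.sub t2).add t3).tendsto_div (s := 36) (by norm_num)
  have h2 := (h1.sub (tendsto_eulOne.mul tendsto_eulTwo)).div tendsto_unD (by norm_num)
  norm_num only at h2
  refine h2.congr fun m => ?_
  rw [unExcess_eq, Pi.div_apply, show (36 : ℝ) ^ m = 4 ^ m * 9 ^ m by rw [← mul_pow]; norm_num,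
    div_pow, show (16 : ℝ) ^ m = 4 ^ m * 4 ^ m by rw [← mul_pow]; norm_num]
  field_simp
  ring

/-- The part of the increment of `N - e₁ D` without the term `-2 e₂ f₁₀`. -/
def incrExcess (m : ℕ) : ℝ :=
  -((((2 * m : ℕ) : ℝ) - 1) * (eulOne (2 * m) *
      ((optY oldDir m - optY 0 m) * (optY oldDir m + optY 0 m)))) -
    4 * ((optY oldDir m - optY 0 m) * eulTwo (2 * m)) -
    2 * (optY oldDir m * planeCoeff (newDir m) (2 * m) 1 1) +
    eulOne (2 * m) * planeCoeff (newDir m) (2 * m) 2 0 -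
    planeCoeff (newDir m) (2 * m) 1 0 * planeCoeff (newDir m) (2 * m) 1 1 +
    2 * planeCoeff (newDir m) (2 * m) 1 2 + planeCoeff (newDir m) (2 * m) 2 1

/-- The part of the increment of `D` without the term `2 e₁ f₁₀`. -/
def incrD (m : ℕ) : ℝ :=
  ((2 * m : ℕ) : ℝ) * ((optY oldDir m - optY 0 m) * (optY oldDir m + optY 0 m)) +
    2 * ((optY oldDir m - optY 0 m) * eulOne (2 * m)) +
    2 * (optY oldDir m * planeCoeff (newDir m) (2 * m) 1 0) +
    planeCoeff (newDir m) (2 * m) 1 0 * planeCoeff (newDir m) (2 * m) 1 0 -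
    2 * planeCoeff (newDir m) (2 * m) 1 1 - 2 * planeCoeff (newDir m) (2 * m) 2 0

lemma newD_sub_unD (m : ℕ) :
    newD m - unD m = incrD m + 2 * eulOne (2 * m) * planeCoeff (newDir m) (2 * m) 1 0 := by
  rw [newD_eq, yVal_two_mul, unD, formD_zero, formD, incrD]; ring

lemma newExcess_sub_unExcess (m : ℕ) :
    newN m - eulOne (2 * m) * newD m - unExcess m =
      incrExcess m - 2 * eulTwo (2 * m) * planeCoeff (newDir m) (2 * m) 1 0 := by
  rw [newN_eq, newD_eq, yVal_two_mul, unExcess_eq, formN, formD, incrExcess]; ring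

/-- The limit comes from `2f₁₂` alone. The term `y f₁₁` has the same rate `18 = (9/4)·8` and
disappears only because `y = o((9/4)^m)`. -/
lemma tendsto_incrExcess : Tendsto (fun m => incrExcess m / 18 ^ m) atTop (𝓝 (-(3 / 2))) := by
  have hz := isSlight_zero.softO_optY
  have hy := isSlight_oldDir.softO_optY
  have hd := isSlight_oldDir.softO_optY_sub
  have f0 := softO_planeCoeff_one_zero_newDir
  have f1 : SoftO 8 _ := .of_tendsto (by norm_num) tendsto_planeCoeff_one_one_newDir
  have t1 := ((softO_two_mul.sub (softO_const 1)).mul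
    (softO_eulOne.mul (hd.mul (hy.add hz)))).mono (s := 16) (by norm_num)
  have t2 := ((hd.mul softO_eulTwo).mono (s := 16) (by norm_num)).const_mul 4
  have t4 := (softO_eulOne.mul softO_planeCoeff_two_zero_newDir).mono (s := 16) (by norm_num)
  have t5 := (f0.mul f1).mono (s := 16) (by norm_num)
  have h1 := ((((t1.neg.sub t2).add t4).sub t5).add softO_planeCoeff_two_one_newDir).tendsto_div
    (s := 18) (by norm_num)
  have h2 := (isSlight_oldDir.tendsto_optY.mul tendsto_planeCoeff_one_one_newDir).const_mul 2
  have h3 := (h1.sub h2).add (tendsto_planeCoeff_one_two_newDir.const_mul 2)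
  norm_num only at h3
  refine h3.congr fun m => ?_
  rw [incrExcess, show (18 : ℝ) ^ m = (9 / 4) ^ m * 8 ^ m by rw [← mul_pow]; norm_num]
  field_simp
  ring

lemma tendsto_incrD : Tendsto (fun m => incrD m / 8 ^ m) atTop (𝓝 2) := by
  have hz := isSlight_zero.softO_optY
  have hy := isSlight_oldDir.softO_optY
  have hd := isSlight_oldDir.softO_optY_sub
  have f0 := softO_planeCoeff_one_zero_newDir
  have t1 := (softO_two_mul.mul (hd.mul (hy.add hz))).mono (s := 9 / 2) (by norm_num)
  have t2 := ((hd.mul softO_eulOne).mono (s := 9 / 2) (by norm_num)).const_mul 2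
  have t3 := ((hy.mul f0).mono (s := 9 / 2) (by norm_num)).const_mul 2
  have t4 := (f0.mul f0).mono (s := 9 / 2) (by norm_num)
  have t5 := (softO_planeCoeff_two_zero_newDir.mono (s := 9 / 2) (by norm_num)).const_mul 2
  have h1 := ((((t1.add t2).add t3).add t4).sub t5).tendsto_div (s := 8) (by norm_num)
  have h3 := h1.sub (tendsto_planeCoeff_one_one_newDir.const_mul 2)
  norm_num only at h3
  refine h3.congr fun m => ?_
  rw [incrD]
  ring

/-- This multiplies `f₁₀` in the final numerator. Its two parts contain `e₁²e₂` with opposite signs,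
so the order drops from `144^m` to `81^m`. -/
lemma softO_cross :
    SoftO 81 (fun m => eulTwo (2 * m) * unD m + eulOne (2 * m) * unExcess m) := by
  have e1 := softO_eulOne
  have e2 := softO_eulTwo
  have hN := softO_two_mul
  have hz := isSlight_zero.softO_optY
  have t1 := (hN.mul (e2.mul (hz.mul hz))).mono (s := 81) (by norm_num)
  have t2 := ((hz.mul (e1.mul e2)).mono (s := 81) (by norm_num)).const_mul (-2)
  have t3 := ((e2.mul e2).mono (s := 81) (by norm_num)).const_mul (-2)
  have t4 := ((hN.sub (softO_const 1)).mul (e1.mul (e1.mul (hz.mul hz)))).mono (s := 81)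
    (by norm_num)
  have t5 := ((e1.mul softO_eulThree).mono (s := 81) (by norm_num)).const_mul 3
  refine ((((t1.add t2).add t3).sub t4).add t5).congr (Eventually.of_forall fun m => ?_)
  rw [unExcess_eq, unD, formD_zero]
  ring

/-- Shifting both quotients by the same `e` removes their common leading part before the comparison.
-/
lemma div_sub_div_eq_of_excess {N D N₁ D₁ e : ℝ} (hD : D ≠ 0) (hD₁ : D₁ ≠ 0) :
    N / D - N₁ / D₁ = ((N - e * D - (N₁ - e * D₁)) - (N₁ - e * D₁) / D₁ * (D - D₁)) / D := by
  field_simp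
  ring

lemma tendsto_difference :
    Tendsto (fun m => (multBound m - unBound (2 * m)) / (9 / 8) ^ m) atTop (𝓝 (3 / 8)) := by
  -- The rate `288 = 18·16` combines the scale of the numerator with that of `D₁`; the product grows
  -- only like `162^m` up to a polynomial.
  have h1 := ((softO_planeCoeff_one_zero_newDir.mul softO_cross).tendsto_div (s := 288)
    (by norm_num)).div tendsto_unD (by norm_num)
  have h2 := (((h1.const_mul (-2)).add tendsto_incrExcess).sub
    (tendsto_unExcess_div.mul tendsto_incrD)).div tendsto_newD (by norm_num)
  norm_num only at h2
  refine h2.congr' ?_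
  filter_upwards [unBound_two_mul,
    eventually_pos_of_tendsto_div (by norm_num) (by norm_num) tendsto_unD,
    eventually_pos_of_tendsto_div (by norm_num) (by norm_num) tendsto_newD] with m hu hD₁ hD
  have hD' := hD.ne'
  have hD₁' := hD₁.ne'
  rw [hu, multBound, div_sub_div_eq_of_excess (e := eulOne (2 * m)) hD' hD₁', ← unExcess,
    newExcess_sub_unExcess, newD_sub_unD]
  simp only [Pi.div_apply]
  rw [show (288 : ℝ) ^ m = 9 ^ m * 2 ^ m * (4 ^ m * 4 ^ m) by
      rw [← mul_pow, ← mul_pow, ← mul_pow]; norm_num,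
    show (18 : ℝ) ^ m = 9 ^ m * 2 ^ m by rw [← mul_pow]; norm_num, div_pow, div_pow,
    show (16 : ℝ) ^ m = 4 ^ m * 4 ^ m by rw [← mul_pow]; norm_num,
    show (8 : ℝ) ^ m = 4 ^ m * 2 ^ m by rw [← mul_pow]; norm_num,
    show (4 : ℝ) ^ m = 2 ^ m * 2 ^ m by rw [← mul_pow]; norm_num]
  field_simp
  ring

end EulerianRelaxation

end

/-! ### The main theorem. -/

theorem mainTheorem2 :
    -- for large `m`, the quantities that define the multivariate bound make sense
    (∀ᶠ m : ℕ in Filter.atTop,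
      EulerianRelaxation.critA (2 * m) ≠ 0 ∧ 0 ≤ EulerianRelaxation.critDisc (2 * m) ∧
        0 < EulerianRelaxation.newD m ∧ 0 < EulerianRelaxation.newN m) ∧
    -- the difference of the bounds is asymptotically `(3/8) (9/8)^m`
    Asymptotics.IsEquivalent Filter.atTop
      (fun m : ℕ => EulerianRelaxation.multBound m - EulerianRelaxation.unBound (2 * m))
      (fun m : ℕ => (3 / 8 : ℝ) * (9 / 8 : ℝ) ^ m) ∧
    -- it tends to infinity
    Filter.Tendsto
      (fun m : ℕ => EulerianRelaxation.multBound m - EulerianRelaxation.unBound (2 * m))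
      Filter.atTop Filter.atTop ∧
    -- and it does so exponentially
    (∃ c C : ℝ, 0 < c ∧ ∀ᶠ m : ℕ in Filter.atTop,
      c * (9 / 8 : ℝ) ^ m ≤
          EulerianRelaxation.multBound m - EulerianRelaxation.unBound (2 * m) ∧
        EulerianRelaxation.multBound m - EulerianRelaxation.unBound (2 * m) ≤
          C * (9 / 8 : ℝ) ^ m) := by
  have hlim := EulerianRelaxation.tendsto_difference
  -- Any two constants around the limit `3/8` would do.
  have hbounds : ∀ᶠ m : ℕ in Filter.atTop,
      1 / 4 * (9 / 8 : ℝ) ^ m ≤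
          EulerianRelaxation.multBound m - EulerianRelaxation.unBound (2 * m) ∧
        EulerianRelaxation.multBound m - EulerianRelaxation.unBound (2 * m) ≤
          1 / 2 * (9 / 8 : ℝ) ^ m := by
    filter_upwards [hlim.eventually_const_lt (show (1 / 4 : ℝ) < 3 / 8 by norm_num),
      hlim.eventually_lt_const (show (3 / 8 : ℝ) < 1 / 2 by norm_num)] with m h1 h2
    rw [lt_div_iff₀ (by positivity)] at h1
    rw [div_lt_iff₀ (by positivity)] at h2
    exact ⟨h1.le, h2.le⟩
  refine ⟨?_, ?_, ?_, 1 / 4, 1 / 2, by norm_num, hbounds⟩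
  · filter_upwards [EulerianRelaxation.isSlight_oldDir.optBounds,
      EulerianRelaxation.eventually_six_le,
      EulerianRelaxation.eventually_pos_of_tendsto_div (by norm_num) (by norm_num)
        EulerianRelaxation.tendsto_newD,
      EulerianRelaxation.eventually_pos_of_tendsto_div (by norm_num) (by norm_num)
        EulerianRelaxation.tendsto_newN] with m hm hN hD hN'
    have hdisc := (hm.smallRoot_spec hN).1
    have ha := hm.a_pos
    refine ⟨?_, ?_, hD, hN'⟩
    · rw [EulerianRelaxation.critA_eq]
      positivity
    · rw [EulerianRelaxation.critDisc_eq, EulerianRelaxation.optDisc]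
      linarith
  · refine Asymptotics.isEquivalent_of_tendsto_one ?_
    have h := hlim.const_mul (8 / 3)
    norm_num only at h
    refine h.congr fun m => ?_
    rw [Pi.div_apply]
    field_simp
  · refine Filter.tendsto_atTop_mono' _ (hbounds.mono fun m h => h.1) ?_
    exact (tendsto_pow_atTop_atTop_of_one_lt (by norm_num)).const_mul_atTop (by norm_num)
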